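/- **Conventions.** Smooth means $C^\infty$. A diffeology on a set $X$ is a set of maps ("plots") from open subsets of Euclidean spaces to $X$ that contains the constant maps, is local, and is closed under precomposition with smooth maps. The diffeology generated by a family of such maps consists of the maps that are, locally, either constant or the composition of a member of the family with a smooth map. In the D-topology of $X$, a set is open iff its preimage under every plot is open; $X$ is called Hausdorff if its D-topology is. In a quotient of $X$, a map is a plot iff it lifts locally to a plot of $X$. A diffeological space $X$ is locally diffeomorphic to $Y$ at $x$ if there are a set $A\ni x$ in $X$ and an injective map $f:A\to Y$ such that $f\circ p$ is a plot of $Y$ for each plot $p$ of $X$ and $f^{-1}\circ q$ is a plot of $X$ for each plot $q$ of $Y$ (in particular, their domains $p^{-1}(A)$ and $q^{-1}(f(A))$ are open). A *reflection-free diffeological orbifold* is a diffeological space that is locally diffeomorphic, at each point, to some $\mathbb R^n/\Gamma$, where $\Gamma$ is a finite group acting linearly on $\mathbb R^n$, no element of which acts as a reflection, i.e. as a linear map whose fixed point set has codimension one ($n$ may depend on the point). Let $M$ be a Hausdorff space. A *local uniformizing system* (l.u.s.) for an open set $U\subset M$ is a triple $(\tilde U,G,\varphi)$, where $\tilde U$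 is a non-empty connected open subset of some $\mathbb R^n$, $G$ is a finite group of diffeomorphisms of $\tilde U$ such that the fixed point set of each non-identity element has codimension $\ge 2$ (or is empty), and $\varphi:\tilde U\to U$ induces a homeomorphism $\tilde U/G\to U$. An *injection* $(\tilde U,G,\varphi)\to(\tilde U',G',\varphi')$ is a diffeomorphism $\lambda$ of $\tilde U$ onto an open subset of $\tilde U'$ with $\varphi=\varphi'\circ\lambda$. A *defining family* on $M$ is a set $\mathcal F$ of l.u.s.'s for open subsets of $M$ such that (1) the sets $\varphi(\tilde U)$, $(\tilde U,G,\varphi)\in\mathcal F$, cover $M$, and whenever $p$ lies in two of them, $U_1$ and $U_2$, it lies in a third one contained in $U_1\cap U_2$; (2) if $(\tilde U,G,\varphi),(\tilde U',G',\varphi')\in\mathcal F$ and $\varphi(\tilde U)\subset\varphi'(\tilde U')$, then there is an injection from the first to the second. Two defining families are *directly equivalent* if some defining family contains both, and *equivalent* if they are joined by a finite chain of direct equivalences. A *V-manifold* (Satake) is a Hausdorff space with an equivalence class of defining families. A defining family generates a diffeology on $M$, namely the one generated by its maps $\varphi:\tilde U\to M$. **Theorem.** Let $M$ be a set. 1.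 If $M$ is equipped with a V-manifold structure, then $M$, with the diffeology generated by any defining family in the given equivalence class, is a Hausdorff reflection-free diffeological orbifold, and its D-topology is the given topology of $M$. 2. Two defining families on a Hausdorff space $M$ generate the same diffeology if and only if they are equivalent. 3. The diffeology determines the V-manifold structure: if two V-manifold structures on $M$ have defining families that generate the same diffeology, then they coincide (the same topology and the same equivalence class). 4. Every Hausdorff reflection-free diffeological orbifold arises in this way: if a diffeology on $M$ makes $M$ a Hausdorff reflection-free diffeological orbifold, then there is a V-manifold structure on $M$, whose topology is the D-topology, with a defining family that generates the given diffeology. -/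

import Mathlib

open Topology TopologicalSpace ContDiff Diffeology

universe u

noncomputable section

namespace Orbi

/-- The Euclidean space `ℝⁿ`. -/
abbrev E (n : ℕ) : Type := EuclideanSpace ℝ (Fin n)

/-- A `C^∞` map from an open subset `U` of `ℝⁿ` to `ℝᵐ`. -/
def IsSmooth {n m : ℕ} {U : Opens (E n)} (f : U → E m) : Prop :=
  ∃ F : E n → E m, ContDiffOn ℝ ∞ F U ∧ ∀ x : U, F x = f x

/-! ### Diffeology

Mathlib's `DiffeologicalSpace` records the plots whose domain is a whole space `ℝⁿ`. The plots on an
arbitrary open subset of `ℝⁿ` are recovered from these by `IsPlotOn`. -/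

section Diffeology

/-- `p : U → X`, with `U` open in `ℝⁿ`, is a plot. -/
def IsPlotOn {X : Type*} [DiffeologicalSpace X] {n : ℕ} (U : Opens (E n)) (p : U → X) : Prop :=
  ∀ (m : ℕ) (r : E m → U), ContDiff ℝ ∞ (fun x ↦ (r x : E n)) → IsPlot (p ∘ r)

/-- A parametrization on a set `X`: a map to `X` from an open subset of some `ℝⁿ`. -/
structure Parametrization (X : Type*) where
  /-- the dimension of the domain -/
  dim : ℕ
  /-- the domain -/
  dom : Opens (E dim)
  /-- the map -/
  toFun : dom → X

/-- The diffeology generated by a family of parametrizations: a map is a plot if and only if it is,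
locally, either constant or the composition of a member of the family with a smooth map. -/
@[reducible]
def generatedDiffeology {X : Type*} (𝔉 : Set (Parametrization X)) : DiffeologicalSpace X :=
  .ofCorePlotsOn {
    isPlotOn := fun {n u} _ q ↦ ∀ x ∈ u, ∃ W : Set (E n), IsOpen W ∧ x ∈ W ∧ W ⊆ u ∧
      ((∃ c : X, ∀ y ∈ W, q y = c) ∨
        ∃ P ∈ 𝔉, ∃ F : E n → E P.dim, ContDiffOn ℝ ∞ F W ∧
          ∀ y ∈ W, ∃ h : F y ∈ P.dom, q y = P.toFun ⟨F y, h⟩)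
    isPlotOn_congr := by
      intro n u hu p q h
      have key : ∀ {p q : E n → X}, Set.EqOn p q u →
          (∀ x ∈ u, ∃ W : Set (E n), IsOpen W ∧ x ∈ W ∧ W ⊆ u ∧
            ((∃ c : X, ∀ y ∈ W, p y = c) ∨
              ∃ P ∈ 𝔉, ∃ F : E n → E P.dim, ContDiffOn ℝ ∞ F W ∧
                ∀ y ∈ W, ∃ h : F y ∈ P.dom, p y = P.toFun ⟨F y, h⟩)) →
          (∀ x ∈ u, ∃ W : Set (E n), IsOpen W ∧ x ∈ W ∧ W ⊆ u ∧
            ((∃ c : X, ∀ y ∈ W, q y = c) ∨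
              ∃ P ∈ 𝔉, ∃ F : E n → E P.dim, ContDiffOn ℝ ∞ F W ∧
                ∀ y ∈ W, ∃ h : F y ∈ P.dom, q y = P.toFun ⟨F y, h⟩)) := by
        intro p q h H x hx
        obtain ⟨W, hW, hxW, hWu, H'⟩ := H x hx
        refine ⟨W, hW, hxW, hWu, ?_⟩
        rcases H' with ⟨c, hc⟩ | ⟨P, hP, F, hF, H'⟩
        · exact Or.inl ⟨c, fun y hy ↦ (h (hWu hy)).symm.trans (hc y hy)⟩
        · refine Or.inr ⟨P, hP, F, hF, fun y hy ↦ ?_⟩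
          obtain ⟨h', e⟩ := H' y hy
          exact ⟨h', (h (hWu hy)).symm.trans e⟩
      exact ⟨key h, key h.symm⟩
    isPlot_const := fun c x _ ↦
      ⟨Set.univ, isOpen_univ, trivial, subset_rfl, Or.inl ⟨c, fun _ _ ↦ rfl⟩⟩
    isPlotOn_reparam := by
      intro n m u v hu hv p f h hp hf x hx
      obtain ⟨W, hW, hxW, hWu, H⟩ := hp (f x) (h hx)
      refine ⟨v ∩ f ⁻¹' W, hf.continuousOn.isOpen_inter_preimage hv hW, ⟨hx, hxW⟩,
        Set.inter_subset_left, ?_⟩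
      rcases H with ⟨c, hc⟩ | ⟨P, hP, F, hF, H⟩
      · exact Or.inl ⟨c, fun y hy ↦ hc _ hy.2⟩
      · exact Or.inr ⟨P, hP, F ∘ f, hF.comp (hf.mono Set.inter_subset_left) (fun y hy ↦ hy.2),
          fun y hy ↦ H _ hy.2⟩
    locality := by
      intro n u hu p H x hx
      obtain ⟨v, hv, hxv, H'⟩ := H x hx
      obtain ⟨W, hW, hxW, hWv, H''⟩ := H' x hxv
      refine ⟨W ∩ u, hW.inter hu, ⟨hxW, hx⟩, Set.inter_subset_right, ?_⟩
      rcases H'' with ⟨c, hc⟩ | ⟨P, hP, F, hF, H''⟩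
      · exact Or.inl ⟨c, fun y hy ↦ hc _ hy.1⟩
      · exact Or.inr ⟨P, hP, F, hF.mono Set.inter_subset_left, fun y hy ↦ H'' _ hy.1⟩ }

/-- The quotient diffeology: a map to the quotient is a plot if and only if it lifts, locally, to a
plot of `X`. -/
@[reducible]
def quotientDiffeology (X : Type*) [DiffeologicalSpace X] (s : Setoid X) :
    DiffeologicalSpace (Quotient s) :=
  .ofCorePlotsOn {
    isPlotOn := fun {n u} _ p ↦ ∀ x ∈ u, ∃ V : Opens (E n), x ∈ V ∧ (V : Set (E n)) ⊆ u ∧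
      ∃ p' : V → X, IsPlotOn V p' ∧ ∀ y : V, p y = Quotient.mk s (p' y)
    isPlotOn_congr := by
      intro n u hu p q h
      constructor
      · intro H x hx
        obtain ⟨V, hxV, hVu, p', hp', H⟩ := H x hx
        exact ⟨V, hxV, hVu, p', hp', fun y ↦ (h (hVu y.2)).symm.trans (H y)⟩
      · intro H x hx
        obtain ⟨V, hxV, hVu, p', hp', H⟩ := H x hx
        exact ⟨V, hxV, hVu, p', hp', fun y ↦ (h (hVu y.2)).trans (H y)⟩
    isPlot_const := by
      intro n c x _
      obtain ⟨a, rfl⟩ := Quotient.exists_rep c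
      exact ⟨⊤, trivial, fun _ _ ↦ trivial, fun _ ↦ a, fun m r _ ↦ isPlot_const, fun _ ↦ rfl⟩
    isPlotOn_reparam := by
      intro n m u v hu hv p f h hp hf x hx
      obtain ⟨V, hxV, hVu, p', hp', H⟩ := hp (f x) (h hx)
      refine ⟨⟨v ∩ f ⁻¹' V, hf.continuousOn.isOpen_inter_preimage hv V.isOpen⟩, ⟨hx, hxV⟩,
        Set.inter_subset_left, fun y ↦ p' ⟨f y, y.2.2⟩, fun k r hr ↦ ?_, fun y ↦ H ⟨f y, y.2.2⟩⟩
      refine hp' k (fun z ↦ ⟨f (r z), (r z).2.2⟩) ?_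
      exact contDiffOn_univ.1 (hf.comp hr.contDiffOn fun z _ ↦ (r z).2.1)
    locality := by
      intro n u hu p H x hx
      obtain ⟨v, hv, hxv, H'⟩ := H x hx
      obtain ⟨V, hxV, hVv, p', hp', H''⟩ := H' x hxv
      refine ⟨⟨V ∩ u, V.isOpen.inter hu⟩, ⟨hxV, hx⟩, Set.inter_subset_right,
        fun y ↦ p' ⟨y, y.2.1⟩, fun k r hr ↦ ?_, fun y ↦ H'' ⟨y, y.2.1⟩⟩
      exact hp' k (fun z ↦ ⟨r z, (r z).2.1⟩) hr }

/-- `X` is locally diffeomorphic to `Y` at `x`: there are a set `A` containing `x` and a one-to-one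
function `f` from `A` to `Y`, with image `B`, such that composing plots of `X` with `f`, and plots
of `Y` with `f⁻¹`, gives plots. This includes that the domains of the compositions are open. -/
def LocallyDiffeomorphicAt (X Y : Type*) [DiffeologicalSpace X] [DiffeologicalSpace Y]
    (x : X) : Prop :=
  ∃ (A : Set X) (B : Set Y) (f : A ≃ B), x ∈ A ∧
    (∀ (n : ℕ) (p : E n → X), IsPlot p → ∃ h : IsOpen (p ⁻¹' A),
      IsPlotOn ⟨p ⁻¹' A, h⟩ (fun u ↦ (f ⟨p u, u.2⟩ : Y))) ∧
    (∀ (n : ℕ) (q : E n → Y), IsPlot q → ∃ h : IsOpen (q ⁻¹' B),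
      IsPlotOn ⟨q ⁻¹' B, h⟩ (fun v ↦ (f.symm ⟨q v, v.2⟩ : X)))

/-- The quotient `ℝⁿ / Γ` by a group of linear automorphisms. -/
abbrev LinearQuotient {n : ℕ} (Γ : Subgroup (E n ≃ₗ[ℝ] E n)) : Type :=
  Quotient (MulAction.orbitRel Γ (E n))

instance {n : ℕ} (Γ : Subgroup (E n ≃ₗ[ℝ] E n)) : DiffeologicalSpace (LinearQuotient Γ) :=
  quotientDiffeology (E n) (MulAction.orbitRel Γ (E n))

/-- A reflection: a linear map whose fixed point set has codimension one. -/
def IsReflection {n : ℕ} (γ : E n ≃ₗ[ℝ] E n) : Prop :=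
  Module.finrank ℝ (LinearMap.eqLocus (γ : E n →ₗ[ℝ] E n) LinearMap.id) + 1 = n

/-- A reflection free diffeological orbifold: a diffeological space that is locally diffeomorphic at
each point to some `ℝⁿ / Γ`, where `Γ` is a finite group acting linearly and without reflections.
Only the image of the action in the linear group matters, so `Γ` is taken to be a subgroup. The
dimension `n` may depend on the point. -/
def IsReflectionFreeOrbifold (X : Type*) [DiffeologicalSpace X] : Prop :=
  ∀ x : X, ∃ (n : ℕ) (Γ : Subgroup (E n ≃ₗ[ℝ] E n)), Finite Γ ∧ (∀ γ ∈ Γ, ¬ IsReflection γ) ∧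
    LocallyDiffeomorphicAt X (LinearQuotient Γ) x

end Diffeology

/-! ### V-manifolds -/

section VManifold

/-- A subset of `ℝⁿ` has codimension at least `k`: it is empty, or its dimension (Hausdorff
dimension, which for a countable union of embedded submanifolds is the largest of their dimensions)
is at most `n - k`. -/
def CodimGE {n : ℕ} (k : ℕ) (S : Set (E n)) : Prop :=
  S = ∅ ∨ dimH S + k ≤ n

/-- A local uniformizing system `(Ũ, G, φ)` for an open subset of `M`, namely for the image
of `φ`. -/
structure LUS (M : Type u) [TopologicalSpace M] where
  /-- the dimension -/
  dim : ℕ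
  /-- the open set `Ũ` -/
  dom : Opens (E dim)
  /-- `Ũ` is connected (and non-empty) -/
  connected : IsConnected (dom : Set (E dim))
  /-- the group `G` of diffeomorphisms of `Ũ` -/
  group : Subgroup (Equiv.Perm dom)
  finite : Finite group
  /-- the elements of `G` (hence also their inverses) are smooth -/
  smooth : ∀ g ∈ group, IsSmooth (fun x : dom ↦ (g x : E dim))
  codim : ∀ g ∈ group, g ≠ 1 →
    CodimGE 2 ((fun x : dom ↦ (x : E dim)) '' {x | g x = x})
  /-- the map `φ` -/
  φ : dom → M
  isOpen_range : IsOpen (Set.range φ)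
  /-- `φ` induces a homeomorphism between `Ũ / G` and its image -/
  homeo : ∃ h : Quotient (MulAction.orbitRel group dom) ≃ₜ Set.range φ,
    ∀ x : dom, (h (Quotient.mk _ x) : M) = φ x

variable {M : Type u}

/-- `l` is an injection from the local uniformizing system `L` to `L'`: a diffeomorphism of `Ũ` onto
an open subset of `Ũ'` such that `φ = φ' ∘ l`. -/
def IsInjection [TopologicalSpace M] (L L' : LUS M) (l : L.dom → L'.dom) : Prop :=
  IsSmooth (fun x ↦ (l x : E L'.dim)) ∧
  IsOpen (Set.range fun x ↦ (l x : E L'.dim)) ∧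
  (∃ μ : E L'.dim → E L.dim, ContDiffOn ℝ ∞ μ (Set.range fun x ↦ (l x : E L'.dim)) ∧
    ∀ x, μ (l x) = x) ∧
  L.φ = L'.φ ∘ l

/-- A set is uniformized by a family of local uniformizing systems if it is the image of one of
its members. -/
def Uniformized [TopologicalSpace M] (F : Set (LUS M)) (U : Set M) : Prop :=
  ∃ L ∈ F, Set.range L.φ = U

/-- A defining family. -/
structure IsDefiningFamily [TopologicalSpace M] (F : Set (LUS M)) : Prop where
  covers : ∀ p : M, ∃ U, Uniformized F U ∧ p ∈ U
  refines : ∀ (p : M) (U₁ U₂ : Set M), Uniformized F U₁ → Uniformized F U₂ → p ∈ U₁ → p ∈ U₂ →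
    ∃ U₃, Uniformized F U₃ ∧ p ∈ U₃ ∧ U₃ ⊆ U₁ ∩ U₂
  inject : ∀ L ∈ F, ∀ L' ∈ F, Set.range L.φ ⊆ Set.range L'.φ → ∃ l, IsInjection L L' l

variable (M) in
/-- The type of defining families on `M`. -/
abbrev DefiningFamily [TopologicalSpace M] : Type u := {F : Set (LUS M) // IsDefiningFamily F}

/-- Direct equivalence: there is a third defining family that contains both. -/
def DirectlyEquivalent [TopologicalSpace M] (F F' : DefiningFamily M) : Prop :=
  ∃ F'' : DefiningFamily M, F.1 ⊆ F''.1 ∧ F'.1 ⊆ F''.1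

/-- Equivalence: there is a chain of direct equivalences from `F` to `F'`. -/
def Equivalent [TopologicalSpace M] (F F' : DefiningFamily M) : Prop :=
  Relation.ReflTransGen DirectlyEquivalent F F'

variable (M) in
/-- Equivalence of defining families is an equivalence relation. -/
@[reducible]
def familySetoid [TopologicalSpace M] : Setoid (DefiningFamily M) where
  r := Equivalent
  iseqv :=
    { refl := fun _ ↦ Relation.ReflTransGen.refl
      symm := fun h ↦ by
        induction h with
        | refl => exact Relation.ReflTransGen.refl
        | tail _ h ih =>
          obtain ⟨F'', h₁, h₂⟩ := h
          exact Relation.ReflTransGen.head ⟨F'', h₂, h₁⟩ ih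
      trans := fun h h' ↦ Relation.ReflTransGen.trans h h' }

/-- The diffeology generated by the maps `φ` of a defining family. -/
@[reducible]
def DefiningFamily.diffeology [TopologicalSpace M] (F : DefiningFamily M) : DiffeologicalSpace M :=
  generatedDiffeology ((fun L : LUS M ↦ Parametrization.mk L.dim L.dom L.φ) '' F.1)

variable (M) in
/-- A V-manifold structure on the set `M`: a Hausdorff topology together with an equivalence class
of defining families. -/
structure VManifold where
  /-- the topology -/
  top : TopologicalSpace M
  t2 : T2Space M
  /-- the equivalence class of defining families -/
  cls : Quotient (familySetoid M)

/-- The defining families that belong to the given equivalence class. -/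
def VManifold.families (V : VManifold M) : Set (@DefiningFamily M V.top) :=
  {F | Quotient.mk (@familySetoid M V.top) F = V.cls}

/-- The diffeology on a V-manifold generated by a defining family. -/
@[reducible]
def VManifold.diffeology (V : VManifold M) (F : @DefiningFamily M V.top) : DiffeologicalSpace M :=
  @DefiningFamily.diffeology M V.top F

end VManifold

end Orbi

end

/-! The pivot is a notion of chart that depends on the diffeology alone (`IsChart`): φ is a plot,
and every plot q with q u = φ z lifts locally through φ to a smooth map that takes u to z. The maps
of a defining family are charts of the diffeology they generate (`IsDefiningFamily.isChart`). Charts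
are continuous and open for the D-topology, so that the topology of M is recovered
(`IsDefiningFamily.dTopology_eq`). It remains to recover the injections from the lifting property.

This rests on rigidity. Bochner's averaging linearizes isotropy groups, so an element of G is
determined by its value and derivative at one point. By a Baire argument, two smooth lifts over a
connected open set, one of them a submersion, differ by a single element of G
(`LUS.exists_act_eqOn`). Hence a lift between charts is a local diffeomorphism, has unique
continuation, and exists globally over a convex domain (`IsLift.exists_of_convex`). If the group
also fixes a point of its domain, the global lift is injective (`IsLift.injOn`), and therefore an
injection.

Charts with convex domain and a common fixed point are called centered. Linearization provides
arbitrarily small ones in any chart, with a linear group; fixed point sets of codimension at least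
two correspond to the absence of reflections. The set of all centered charts is thus a defining
family that the diffeology determines. Every defining family generating the diffeology is equivalent
to it (`equivalent_centeredCharts`), which gives uniqueness; for an orbifold given by its diffeology
it also gives existence. -/

namespace Orbi

/-! ### Plots on open sets and charts, in terms of total functions -/

section Plots

variable {X : Type*} [DiffeologicalSpace X]

/-- The restriction of `q` to `W` is a plot. -/
def PlotOn {k : ℕ} (W : Set (E k)) (q : E k → X) : Prop :=
  ∀ (m : ℕ) (r : E m → E k), ContDiff ℝ ∞ r → (∀ z, r z ∈ W) → IsPlot (q ∘ r)

lemma isPlotOn_iff_plotOn {k : ℕ} {W : Opens (E k)} {p : W → X} {q : E k → X}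
    (h : ∀ x : W, q x = p x) : IsPlotOn W p ↔ PlotOn (W : Set (E k)) q := by
  constructor
  · intro H m r hr hrW
    have := H m (fun z ↦ ⟨r z, hrW z⟩) hr
    convert this using 1
    ext z
    exact h ⟨r z, hrW z⟩
  · intro H m r hr
    have := H m (fun z ↦ (r z : E k)) hr (fun z ↦ (r z).2)
    convert this using 1
    ext z
    exact (h (r z)).symm

lemma plotOn_univ {k : ℕ} {q : E k → X} : PlotOn Set.univ q ↔ IsPlot q :=
  ⟨fun h ↦ h k id contDiff_id fun _ ↦ trivial, fun h _ _ hr _ ↦ isPlot_reparam h hr⟩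

lemma PlotOn.mono {k : ℕ} {W V : Set (E k)} {q : E k → X} (h : PlotOn W q) (hVW : V ⊆ W) :
    PlotOn V q :=
  fun m r hr hV ↦ h m r hr fun z ↦ hVW (hV z)

lemma PlotOn.congr {k : ℕ} {W : Set (E k)} {q q' : E k → X} (h : PlotOn W q)
    (hq : Set.EqOn q' q W) : PlotOn W q' := by
  intro m r hr hW
  have : q' ∘ r = q ∘ r := funext fun z ↦ hq (hW z)
  exact this ▸ h m r hr hW

lemma PlotOn.comp {k m : ℕ} {W : Set (E k)} {V : Set (E m)} {q : E k → X} {s : E m → E k}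
    (h : PlotOn W q) (hV : IsOpen V) (hs : ContDiffOn ℝ ∞ s V) (hsW : Set.MapsTo s V W) :
    PlotOn V (q ∘ s) := by
  intro j r hr hrV
  refine h j (s ∘ r) ?_ fun z ↦ hsW (hrV z)
  exact contDiff_iff_contDiffAt.2 fun z ↦
    ((hs (r z) (hrV z)).contDiffAt (hV.mem_nhds (hrV z))).comp z hr.contDiffAt

lemma plotOn_of_local {k : ℕ} {W : Set (E k)} {q : E k → X}
    (h : ∀ x ∈ W, ∃ V, IsOpen V ∧ x ∈ V ∧ PlotOn (V ∩ W) q) : PlotOn W q := by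
  intro m r hr hrW
  refine DiffeologicalSpace.locality fun z ↦ ?_
  obtain ⟨V, hV, hxV, H⟩ := h (r z) (hrW z)
  exact ⟨r ⁻¹' V, hV.preimage hr.continuous, hxV, fun {j f} hf hfs ↦
    H j (r ∘ f) (hr.comp hfs) fun y ↦ ⟨hf y, hrW _⟩⟩

lemma isPlot_of_local {k : ℕ} {q : E k → X}
    (h : ∀ x, ∃ V, IsOpen V ∧ x ∈ V ∧ PlotOn V q) : IsPlot q :=
  plotOn_univ.1 <| plotOn_of_local fun x _ ↦ by simpa using h x

/-- A plot on an open set agrees, after a local diffeomorphism of its domain, with a plot. -/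
lemma PlotOn.exists_isPlot {k : ℕ} {W : Set (E k)} (hW : IsOpen W) {q : E k → X}
    (h : PlotOn W q) {x : E k} (hx : x ∈ W) :
    ∃ (q' : E k → X) (V : Set (E k)) (e : E k → E k), IsPlot q' ∧ IsOpen V ∧ x ∈ V ∧ V ⊆ W ∧
      ContDiffOn ℝ ∞ e V ∧ Set.EqOn q (q' ∘ e) V := by
  obtain ⟨ε, hε, hb⟩ := Metric.isOpen_iff.1 hW x hx
  -- A ball is diffeomorphic to the whole space, so the restriction of `q` to a ball becomes a plot
  -- with total domain.
  let b := OpenPartialHomeomorph.univBall x ε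
  have hbt : b.target = Metric.ball x ε := OpenPartialHomeomorph.univBall_target x hε
  have hbs : b.source = Set.univ := OpenPartialHomeomorph.univBall_source x ε
  refine ⟨q ∘ b, Metric.ball x ε, b.symm, ?_, Metric.isOpen_ball, Metric.mem_ball_self hε, hb,
    OpenPartialHomeomorph.contDiffOn_univBall_symm, ?_⟩
  · refine h k b OpenPartialHomeomorph.contDiff_univBall fun z ↦ hb ?_
    rw [← hbt]
    exact b.map_source (hbs ▸ trivial)
  · intro y hy
    simp only [Function.comp]
    rw [b.right_inv (hbt ▸ hy)]

/-- `φ`, restricted to `U`, is a plot through which all plots lift locally. -/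
structure IsChart {n : ℕ} (U : Set (E n)) (φ : E n → X) : Prop where
  plotOn : PlotOn U φ
  lift : ∀ (k : ℕ) (q : E k → X), IsPlot q → ∀ (u : E k) (z : E n), z ∈ U → q u = φ z →
    ∃ (W : Set (E k)) (s : E k → E n), IsOpen W ∧ u ∈ W ∧ ContDiffOn ℝ ∞ s W ∧
      Set.MapsTo s W U ∧ Set.EqOn (φ ∘ s) q W ∧ s u = z

lemma IsChart.lift_plotOn {n : ℕ} {U : Set (E n)} {φ : E n → X} (h : IsChart U φ) {k : ℕ}
    {V : Set (E k)} (hV : IsOpen V) {q : E k → X} (hq : PlotOn V q) {x : E k} (hx : x ∈ V)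
    {z : E n} (hz : z ∈ U) (hqz : q x = φ z) :
    ∃ (W : Set (E k)) (s : E k → E n), IsOpen W ∧ x ∈ W ∧ W ⊆ V ∧ ContDiffOn ℝ ∞ s W ∧
      Set.MapsTo s W U ∧ Set.EqOn (φ ∘ s) q W ∧ s x = z := by
  obtain ⟨q', V', e, hq', hV', hxV', hVV', he, hqe⟩ := hq.exists_isPlot hV hx
  obtain ⟨W, s, hW, hxW, hs, hsU, hsq, hsx⟩ :=
    h.lift k q' hq' (e x) z hz ((hqe hxV').symm.trans hqz)
  refine ⟨V' ∩ e ⁻¹' W, s ∘ e, he.continuousOn.isOpen_inter_preimage hV' hW, ⟨hxV', hxW⟩,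
    fun y hy ↦ hVV' hy.1, hs.comp (he.mono Set.inter_subset_left) fun y hy ↦ hy.2,
    fun y hy ↦ hsU hy.2, fun y hy ↦ ?_, hsx⟩
  exact (hsq hy.2).trans (hqe hy.1).symm

lemma IsChart.continuousOn [TopologicalSpace X] [IsDTopologyCompatible X] {n : ℕ} {U : Set (E n)}
    {φ : E n → X} (h : IsChart U φ) (hU : IsOpen U) : ContinuousOn φ U := by
  intro x hx
  obtain ⟨q', V, e, hq', hV, hxV, hVU, he, hqe⟩ := h.plotOn.exists_isPlot hU hx
  have hc : Continuous q' := by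
    have := hq'.continuous
    rwa [IsDTopologyCompatible.dTop_eq X] at this
  have : ContinuousAt φ x :=
    ((hc.comp_continuousOn he.continuousOn).congr hqe).continuousAt (hV.mem_nhds hxV)
  exact this.continuousWithinAt

/-- A plot that hits the image at `φ z` lifts with value `z`, and the lift stays in `O` nearby; this
is where the freedom to prescribe the value of the lift matters. -/
lemma IsChart.isOpen_image [TopologicalSpace X] [IsDTopologyCompatible X] {n : ℕ} {U : Set (E n)}
    {φ : E n → X} (h : IsChart U φ) {O : Set (E n)} (hO : IsOpen O) (hOU : O ⊆ U) :
    IsOpen (φ '' O) := by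
  rw [← IsDTopologyCompatible.dTop_eq X, isOpen_iff_preimages_plots]
  intro k p hp
  rw [isOpen_iff_mem_nhds]
  rintro x ⟨z, hz, hzx⟩
  obtain ⟨W, s, hW, hxW, hs, hsU, hsq, hsx⟩ := h.lift k p hp x z (hOU hz) hzx.symm
  refine Filter.mem_of_superset ((hs.continuousOn.isOpen_inter_preimage hW hO).mem_nhds
    ⟨hxW, by rwa [Set.mem_preimage, hsx]⟩) ?_
  exact fun y hy ↦ ⟨s y, hy.2, hsq hy.1⟩

end Plots

/-! ### Local uniformizing systems -/

section Action

open Classical in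
/-- A permutation of an open set, extended by the identity. -/
noncomputable def act {n : ℕ} {U : Opens (E n)} : Equiv.Perm U →* Equiv.Perm (E n) :=
  Equiv.Perm.ofSubtype

lemma act_apply {n : ℕ} {U : Opens (E n)} (g : Equiv.Perm U) {x : E n} (hx : x ∈ U) :
    act g x = g ⟨x, hx⟩ := by
  classical exact Equiv.Perm.ofSubtype_apply_of_mem (p := fun x ↦ x ∈ U) g hx

lemma act_mem {n : ℕ} {U : Opens (E n)} (g : Equiv.Perm U) {x : E n} (hx : x ∈ U) :
    act g x ∈ U := by
  rw [act_apply g hx]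
  exact (g ⟨x, hx⟩).2

lemma act_mul {n : ℕ} {U : Opens (E n)} (g h : Equiv.Perm U) (x : E n) :
    act (g * h) x = act g (act h x) := by
  rw [map_mul]; rfl

lemma act_one {n : ℕ} {U : Opens (E n)} (x : E n) : act (1 : Equiv.Perm U) x = x := by
  rw [map_one]; rfl

lemma act_inv_act {n : ℕ} {U : Opens (E n)} (g : Equiv.Perm U) (x : E n) :
    act g⁻¹ (act g x) = x := by
  rw [← act_mul, inv_mul_cancel, act_one]

lemma act_act_inv {n : ℕ} {U : Opens (E n)} (g : Equiv.Perm U) (x : E n) :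
    act g (act g⁻¹ x) = x := by
  rw [← act_mul, mul_inv_cancel, act_one]

variable {M : Type u} [TopologicalSpace M]

namespace LUS

/-- The map `φ`, extended to the whole space. -/
noncomputable def ψ (L : LUS M) : E L.dim → M :=
  open Classical in fun x ↦ if h : x ∈ L.dom then L.φ ⟨x, h⟩
    else L.φ ⟨L.connected.nonempty.some, L.connected.nonempty.some_mem⟩

lemma ψ_apply (L : LUS M) {x : E L.dim} (hx : x ∈ L.dom) : L.ψ x = L.φ ⟨x, hx⟩ := dif_pos hx

lemma ψ_coe (L : LUS M) (x : L.dom) : L.ψ x = L.φ x := L.ψ_apply x.2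

lemma image_ψ (L : LUS M) : L.ψ '' L.dom = Set.range L.φ := by
  ext p
  constructor
  · rintro ⟨x, hx, rfl⟩
    exact ⟨⟨x, hx⟩, (L.ψ_apply hx).symm⟩
  · rintro ⟨x, rfl⟩
    exact ⟨x, x.2, L.ψ_coe x⟩

lemma ψ_mem_range (L : LUS M) {x : E L.dim} (hx : x ∈ L.dom) : L.ψ x ∈ Set.range L.φ :=
  L.ψ_apply hx ▸ ⟨_, rfl⟩

lemma contDiffOn_act (L : LUS M) {g : Equiv.Perm L.dom} (hg : g ∈ L.group) :
    ContDiffOn ℝ ∞ (act g) L.dom := by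
  obtain ⟨F, hF, h⟩ := L.smooth g hg
  exact hF.congr fun x hx ↦ by rw [act_apply g hx, h ⟨x, hx⟩]

lemma contDiffAt_act (L : LUS M) {g : Equiv.Perm L.dom} (hg : g ∈ L.group) {x : E L.dim}
    (hx : x ∈ L.dom) : ContDiffAt ℝ ∞ (act g) x :=
  (L.contDiffOn_act hg).contDiffAt (L.dom.isOpen.mem_nhds hx)

lemma ψ_eq_iff (L : LUS M) {x y : E L.dim} (hx : x ∈ L.dom) (hy : y ∈ L.dom) :
    L.ψ x = L.ψ y ↔ ∃ g ∈ L.group, act g x = y := by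
  obtain ⟨h, hh⟩ := L.homeo
  rw [L.ψ_apply hx, L.ψ_apply hy, ← hh, ← hh, Subtype.coe_inj, h.injective.eq_iff, Quotient.eq]
  rw [MulAction.orbitRel_apply, MulAction.mem_orbit_iff]
  constructor
  · rintro ⟨g, hg⟩
    refine ⟨g⁻¹, L.group.inv_mem g.2, ?_⟩
    have : act (g : Equiv.Perm L.dom) y = x := by
      rw [act_apply _ hy]
      exact congrArg Subtype.val hg
    rw [← this, act_inv_act]
  · rintro ⟨g, hg, hgx⟩
    refine ⟨⟨g⁻¹, L.group.inv_mem hg⟩, ?_⟩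
    apply Subtype.ext
    have : act g⁻¹ y = x := by rw [← hgx, act_inv_act]
    exact (act_apply g⁻¹ hy).symm.trans this

lemma ψ_act (L : LUS M) {g : Equiv.Perm L.dom} (hg : g ∈ L.group) {x : E L.dim}
    (hx : x ∈ L.dom) : L.ψ (act g x) = L.ψ x :=
  ((L.ψ_eq_iff hx (act_mem g hx)).2 ⟨g, hg, rfl⟩).symm

lemma isOpen_image_ψ (L : LUS M) {O : Set (E L.dim)} (hO : IsOpen O) (hOU : O ⊆ L.dom) :
    IsOpen (L.ψ '' O) := by
  obtain ⟨h, hh⟩ := L.homeo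
  have : ContinuousConstSMul L.group L.dom := ⟨fun g ↦ by
    refine continuous_induced_rng.2 ?_
    have := (L.contDiffOn_act g.2).continuousOn.comp_continuous continuous_subtype_val
      (fun x : L.dom ↦ x.2)
    refine this.congr fun x ↦ ?_
    exact act_apply _ x.2⟩
  have hO' : IsOpen ((↑) ⁻¹' O : Set L.dom) := hO.preimage continuous_subtype_val
  have h1 := L.isOpen_range.isOpenMap_subtype_val _ (h.isOpenMap _
    (isOpenMap_quotient_mk'_mul (Γ := L.group) _ hO'))
  convert h1 using 1
  ext p
  constructor
  · rintro ⟨x, hx, rfl⟩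
    exact ⟨_, ⟨_, ⟨⟨x, hOU hx⟩, hx, rfl⟩, rfl⟩, (hh _).trans (L.ψ_apply (hOU hx)).symm⟩
  · rintro ⟨_, ⟨_, ⟨x, hx, rfl⟩, rfl⟩, rfl⟩
    exact ⟨x, hx, (L.ψ_coe x).trans (hh x).symm⟩

lemma continuousOn_ψ (L : LUS M) : ContinuousOn L.ψ L.dom := by
  obtain ⟨h, hh⟩ := L.homeo
  rw [continuousOn_iff_continuous_domRestrict]
  have : Continuous fun x : L.dom ↦ (h (Quotient.mk _ x) : M) :=
    continuous_subtype_val.comp (h.continuous.comp continuous_quotient_mk')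
  refine this.congr fun x ↦ ?_
  rw [hh]
  exact (L.ψ_coe x).symm

end LUS

end Action

/-! ### Rigidity of group elements and uniqueness of lifts -/

section Rigidity

variable {M : Type u} [TopologicalSpace M]

namespace LUS

/-- A fixed point set with an interior point has full Hausdorff dimension, against the codimension
condition. -/
lemma eq_one_of_act_eq_self (L : LUS M) {g : Equiv.Perm L.dom} (hg : g ∈ L.group)
    {x : E L.dim} (hx : x ∈ L.dom) (h : ∀ᶠ y in 𝓝 x, act g y = y) : g = 1 := by
  by_contra hne
  have hmem : (fun x : L.dom ↦ (x : E L.dim)) '' {x | g x = x} ∈ 𝓝 x := by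
    filter_upwards [h, L.dom.isOpen.mem_nhds hx] with y hy hyU
    refine ⟨⟨y, hyU⟩, Subtype.ext ?_, rfl⟩
    rw [← act_apply g hyU]
    exact hy
  rcases L.codim g hg hne with h0 | h0
  · rw [h0] at hmem
    exact (mem_of_mem_nhds hmem).elim
  · rw [Real.dimH_of_mem_nhds hmem, finrank_euclideanSpace_fin] at h0
    have : L.dim + 2 ≤ L.dim := by exact_mod_cast h0
    omega

lemma eq_of_act_eventuallyEq (L : LUS M) {g g' : Equiv.Perm L.dom} (hg : g ∈ L.group)
    (hg' : g' ∈ L.group) {x : E L.dim} (hx : x ∈ L.dom)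
    (h : ∀ᶠ y in 𝓝 x, act g y = act g' y) : g = g' := by
  have : g'⁻¹ * g = 1 := by
    refine L.eq_one_of_act_eq_self (L.group.mul_mem (L.group.inv_mem hg') hg) hx ?_
    filter_upwards [h] with y hy
    rw [act_mul, hy, act_inv_act]
  exact (inv_mul_eq_one.1 this).symm

lemma fderiv_act_mul (L : LUS M) {g h : Equiv.Perm L.dom} (hg : g ∈ L.group)
    (hh : h ∈ L.group) {x : E L.dim} (hx : x ∈ L.dom) :
    fderiv ℝ (act (g * h)) x = (fderiv ℝ (act g) (act h x)).comp (fderiv ℝ (act h) x) := by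
  have : (act (g * h) : E L.dim → E L.dim) = act g ∘ act h := funext (act_mul g h)
  rw [this, fderiv_comp]
  · exact (L.contDiffAt_act hg (act_mem h hx)).differentiableAt (by simp)
  · exact (L.contDiffAt_act hh hx).differentiableAt (by simp)

lemma fderiv_act_one (L : LUS M) (x : E L.dim) :
    fderiv ℝ (act (1 : Equiv.Perm L.dom)) x = ContinuousLinearMap.id ℝ _ := by
  have : (act (1 : Equiv.Perm L.dom) : E L.dim → E L.dim) = id := funext act_one
  rw [this, fderiv_id]

/-- The isotropy group of a point. -/
def stab (L : LUS M) (x : E L.dim) : Subgroup (Equiv.Perm L.dom) where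
  carrier := {g | g ∈ L.group ∧ act g x = x}
  one_mem' := ⟨L.group.one_mem, act_one x⟩
  mul_mem' := fun {a b} ha hb ↦ ⟨L.group.mul_mem ha.1 hb.1, by rw [act_mul, hb.2, ha.2]⟩
  inv_mem' := fun {a} ha ↦ ⟨L.group.inv_mem ha.1, by
    conv_lhs => rw [← ha.2]
    exact act_inv_act a x⟩

lemma finite_stab (L : LUS M) (x : E L.dim) : Finite (L.stab x) :=
  have := L.finite
  Finite.of_injective (fun g : L.stab x ↦ (⟨g, g.2.1⟩ : L.group)) fun a b h ↦ by
    exact Subtype.ext (congrArg (fun g : L.group ↦ (g : Equiv.Perm L.dom)) h)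

/-- Bochner's linearization of the isotropy group of a point. -/
lemma exists_linearization (L : LUS M) {x : E L.dim} (hx : x ∈ L.dom) :
    ∃ T : E L.dim → E L.dim, ContDiffOn ℝ ∞ T L.dom ∧ T x = 0 ∧
      HasFDerivAt T (ContinuousLinearMap.id ℝ (E L.dim)) x ∧
      ∀ g ∈ L.stab x, ∀ y ∈ L.dom, T (act g y) = fderiv ℝ (act g) x (T y) := by
  have := L.finite_stab x
  have := Fintype.ofFinite (L.stab x)
  let D (g : Equiv.Perm L.dom) : E L.dim →L[ℝ] E L.dim := fderiv ℝ (act g) x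
  have hD : ∀ g h : L.stab x, D (g * h : L.stab x) = (D g).comp (D h) := fun g h ↦ by
    have := L.fderiv_act_mul g.2.1 h.2.1 hx
    rw [h.2.2] at this
    exact this
  have hD1 : D (1 : L.stab x) = ContinuousLinearMap.id ℝ _ := L.fderiv_act_one x
  -- The average of the maps y ↦ D(h)⁻¹(h y - x), each of which has derivative the identity at x.
  let S (y : E L.dim) : E L.dim := ∑ h : L.stab x, D (h⁻¹ : L.stab x) (act h.1 y - x)
  let c : ℝ := (Fintype.card (L.stab x) : ℝ)⁻¹
  have hc : c * Fintype.card (L.stab x) = 1 :=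
    inv_mul_cancel₀ (by exact_mod_cast Fintype.card_ne_zero)
  refine ⟨fun y ↦ c • S y, ?_, ?_, ?_, ?_⟩
  · refine ContDiffOn.const_smul c (ContDiffOn.sum fun h _ ↦ ?_)
    exact (D _).contDiff.comp_contDiffOn ((L.contDiffOn_act h.2.1).sub contDiffOn_const)
  · have : S x = 0 := Finset.sum_eq_zero fun h _ ↦ by rw [h.2.2, sub_self, map_zero]
    simp only [this, smul_zero]
  · have h1 : HasFDerivAt S (∑ h : L.stab x, (D (h⁻¹ : L.stab x)).comp (D h)) x := by
      refine HasFDerivAt.fun_sum fun h _ ↦ ?_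
      refine (D _).hasFDerivAt.comp x ?_
      exact ((L.contDiffAt_act h.2.1 hx).differentiableAt (by simp)).hasFDerivAt.sub_const x
    have h2 := h1.const_smul c
    have h3 : ∀ h : L.stab x, (D (h⁻¹ : L.stab x)).comp (D h) = ContinuousLinearMap.id ℝ _ :=
      fun h ↦ by rw [← hD, inv_mul_cancel, hD1]
    simp only [h3, Finset.sum_const, Finset.card_univ] at h2
    rw [← Nat.cast_smul_eq_nsmul ℝ, smul_smul, hc, one_smul] at h2
    exact h2
  · intro g hg y hy
    change c • S _ = D g (c • S y)
    rw [map_smul]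
    congr 1
    simp only [S, map_sum]
    -- Replacing h by h g⁻¹ pulls the factor D(g) out of each summand.
    rw [← Equiv.sum_comp (Equiv.mulRight (⟨g, hg⟩ : L.stab x)⁻¹)]
    refine Finset.sum_congr rfl fun h _ ↦ ?_
    have h1 : D ((h * (⟨g, hg⟩ : L.stab x)⁻¹)⁻¹ : L.stab x)
        = (D g).comp (D (h⁻¹ : L.stab x)) := by
      rw [mul_inv_rev, inv_inv, hD]
    have h2 : act ((h * (⟨g, hg⟩ : L.stab x)⁻¹ : L.stab x) : Equiv.Perm L.dom) (act g y)
        = act h.1 y := by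
      change act ((h : Equiv.Perm L.dom) * g⁻¹) (act g y) = _
      rw [act_mul, act_inv_act]
    simp only [Equiv.coe_mulRight]
    rw [h1, h2]
    rfl

/-- In the linearizing coordinate `T`, which is injective near `x`, the element acts by its
derivative, that is, trivially; so it is the identity near `x`. -/
lemma eq_one_of_fderiv_act (L : LUS M) {g : Equiv.Perm L.dom} (hg : g ∈ L.group)
    {x : E L.dim} (hx : x ∈ L.dom) (h : act g x = x)
    (hd : fderiv ℝ (act g) x = ContinuousLinearMap.id ℝ _) : g = 1 := by
  obtain ⟨T, hT, -, hTx, hTg⟩ := L.exists_linearization hx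
  have hs : HasStrictFDerivAt T
      ((ContinuousLinearEquiv.refl ℝ (E L.dim) : E L.dim ≃L[ℝ] E L.dim) : E L.dim →L[ℝ] E L.dim)
      x := by
    have := (hT.contDiffAt (L.dom.isOpen.mem_nhds hx)).hasStrictFDerivAt (by simp)
    rwa [hTx.fderiv] at this
  let e := hs.toOpenPartialHomeomorph T
  have hxe : x ∈ e.source := hs.mem_toOpenPartialHomeomorph_source
  have hnear := e.open_source.mem_nhds hxe
  refine L.eq_one_of_act_eq_self hg hx ?_
  have hcont : Filter.Tendsto (act g) (𝓝 x) (𝓝 x) := by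
    have := (L.contDiffAt_act hg hx).continuousAt.tendsto
    rwa [h] at this
  filter_upwards [hnear, hcont hnear, L.dom.isOpen.mem_nhds hx] with y h1 h2 h3
  refine e.injOn h2 h1 ?_
  have := hTg g ⟨hg, h⟩ y h3
  rwa [hd] at this

lemma eq_of_fderiv_act (L : LUS M) {g g' : Equiv.Perm L.dom} (hg : g ∈ L.group)
    (hg' : g' ∈ L.group) {x : E L.dim} (hx : x ∈ L.dom) (h : act g x = act g' x)
    (hd : fderiv ℝ (act g) x = fderiv ℝ (act g') x) : g = g' := by
  have : g'⁻¹ * g = 1 := by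
    refine L.eq_one_of_fderiv_act (L.group.mul_mem (L.group.inv_mem hg') hg) hx ?_ ?_
    · rw [act_mul, h, act_inv_act]
    · rw [L.fderiv_act_mul (L.group.inv_mem hg') hg hx, h, hd,
        ← L.fderiv_act_mul (L.group.inv_mem hg') hg' hx, inv_mul_cancel, L.fderiv_act_one]
  exact (inv_mul_eq_one.1 this).symm

/-- Two lifts of a map through `φ`, one of which is a submersion, differ by an element of `G`. -/
lemma exists_act_eqOn (L : LUS M) {k : ℕ} {W : Set (E k)} (hW : IsOpen W)
    (hWc : IsPreconnected W) {s s' : E k → E L.dim} (hs : ContDiffOn ℝ ∞ s W)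
    (hs' : ContDiffOn ℝ ∞ s' W) (hsU : Set.MapsTo s W L.dom) (hsU' : Set.MapsTo s' W L.dom)
    (h : ∀ x ∈ W, L.ψ (s x) = L.ψ (s' x))
    (hd : ∀ x ∈ W, Function.Surjective (fderiv ℝ s x)) :
    ∃ g ∈ L.group, ∀ x ∈ W, s' x = act g (s x) := by
  have := L.finite
  -- Requiring agreement to first order, not just of values, makes these sets disjoint as well as
  -- relatively closed in W. Once they cover W they are also open, because there are finitely many,
  -- and connectedness leaves only one.
  let A (g : L.group) : Set (E k) := {x | x ∈ W ∧ s' x = act g.1 (s x) ∧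
    fderiv ℝ s' x = (fderiv ℝ (act g.1) (s x)).comp (fderiv ℝ s x)}
  have hcs : ∀ g : L.group, ContinuousOn (fun x ↦ act g.1 (s x)) W := fun g ↦
    (L.contDiffOn_act g.2).continuousOn.comp hs.continuousOn hsU
  have hA_closed : ∀ g : L.group, ∀ x ∈ W, x ∈ closure (A g) → x ∈ A g := by
    intro g x hxW hx
    have hne : (𝓝[A g] x).NeBot := mem_closure_iff_nhdsWithin_neBot.1 hx
    have hAW : A g ⊆ W := fun y hy ↦ hy.1
    refine ⟨hxW, ?_, ?_⟩
    · refine tendsto_nhds_unique_of_eventuallyEq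
        ((hs'.continuousOn x hxW).mono_left (nhdsWithin_mono _ hAW))
        ((hcs g x hxW).mono_left (nhdsWithin_mono _ hAW)) ?_
      filter_upwards [self_mem_nhdsWithin] with y hy using hy.2.1
    · have h1 := hs'.continuousOn_fderiv_of_isOpen hW (by simp)
      have h2 : ContinuousOn (fun x ↦ (fderiv ℝ (act g.1) (s x)).comp (fderiv ℝ s x)) W :=
        (((L.contDiffOn_act g.2).continuousOn_fderiv_of_isOpen L.dom.isOpen (by simp)).comp
          hs.continuousOn hsU).clm_comp (hs.continuousOn_fderiv_of_isOpen hW (by simp))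
      refine tendsto_nhds_unique_of_eventuallyEq
        ((h1 x hxW).mono_left (nhdsWithin_mono _ hAW))
        ((h2 x hxW).mono_left (nhdsWithin_mono _ hAW)) ?_
      filter_upwards [self_mem_nhdsWithin] with y hy using hy.2.2
  have hA_disj : ∀ g g' : L.group, ∀ x, x ∈ A g → x ∈ A g' → g = g' := by
    intro g g' x hx hx'
    refine Subtype.ext (L.eq_of_fderiv_act g.2 g'.2 (hsU hx.1) (hx.2.1.symm.trans hx'.2.1) ?_)
    ext1 v
    obtain ⟨w, rfl⟩ := hd x hx.1 v
    exact DFunLike.congr_fun (hx.2.2.symm.trans hx'.2.2) w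
  have hA_int : ∀ g : L.group, ∀ x ∈ W, (∀ᶠ y in 𝓝 x, s' y = act g.1 (s y)) → x ∈ A g := by
    intro g x hxW hx
    refine ⟨hxW, hx.self_of_nhds, ?_⟩
    rw [Filter.EventuallyEq.fderiv_eq (f := fun y ↦ act g.1 (s y)) hx]
    refine fderiv_comp x ((L.contDiffAt_act g.2 (hsU hxW)).differentiableAt (by simp)) ?_
    exact (hs.contDiffAt (hW.mem_nhds hxW)).differentiableAt (by simp)
  have hA_cover : ∀ x ∈ W, ∃ g, x ∈ A g := by
    -- Baire: finitely many closed sets cover the space, with `none` accounting for the complement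
    -- of W. On the interior of a set given by g, the two maps agree on W and hence to first order,
    -- so the union of the `A g` is dense in W; it is also relatively closed.
    let B : Option L.group → Set (E k) := fun o ↦
      o.elim Wᶜ fun g ↦ closure {x | x ∈ W ∧ s' x = act g.1 (s x)}
    have hB : ∀ o, IsClosed (B o) := by
      rintro (_ | g)
      · exact hW.isClosed_compl
      · exact isClosed_closure
    have hBu : ⋃ o, B o = Set.univ := by
      refine Set.eq_univ_of_forall fun x ↦ Set.mem_iUnion.2 ?_
      by_cases hx : x ∈ W
      · obtain ⟨g, hg, hgx⟩ := (L.ψ_eq_iff (hsU hx) (hsU' hx)).1 (h x hx)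
        exact ⟨some ⟨g, hg⟩, subset_closure ⟨hx, hgx.symm⟩⟩
      · exact ⟨none, hx⟩
    have hdense := dense_iUnion_interior_of_closed hB hBu
    intro x hx
    have hx' : x ∈ closure (⋃ g, A g) := by
      rw [mem_closure_iff]
      intro O hO hxO
      obtain ⟨y, ⟨hyO, hyW⟩, hy⟩ := hdense.inter_open_nonempty _ (hO.inter hW) ⟨x, hxO, hx⟩
      obtain ⟨o, ho⟩ := Set.mem_iUnion.1 hy
      rcases o with _ | g
      · exact (interior_subset ho hyW).elim
      · refine ⟨y, hyO, Set.mem_iUnion.2 ⟨g, hA_int g y hyW ?_⟩⟩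
        filter_upwards [isOpen_interior.mem_nhds ho, hW.mem_nhds hyW] with z hz hzW
        have hz' : z ∈ closure {x | x ∈ W ∧ s' x = act g.1 (s x)} := interior_subset hz
        have hne := mem_closure_iff_nhdsWithin_neBot.1 hz'
        have hsub : {x | x ∈ W ∧ s' x = act g.1 (s x)} ⊆ W := fun y hy ↦ hy.1
        refine tendsto_nhds_unique_of_eventuallyEq
          ((hs'.continuousOn z hzW).mono_left (nhdsWithin_mono _ hsub))
          ((hcs g z hzW).mono_left (nhdsWithin_mono _ hsub)) ?_
        filter_upwards [self_mem_nhdsWithin] with y hy using hy.2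
    rw [closure_iUnion_of_finite] at hx'
    obtain ⟨g, hg⟩ := Set.mem_iUnion.1 hx'
    exact ⟨g, hA_closed g x hx hg⟩
  have hA_open : ∀ g, IsOpen (A g) := by
    intro g
    rw [isOpen_iff_mem_nhds]
    intro x hx
    have : ∀ g' : L.group, ∀ᶠ y in 𝓝 x, y ∈ A g' → g' = g := by
      intro g'
      by_cases hgg : g' = g
      · exact Filter.Eventually.of_forall fun _ _ ↦ hgg
      · have hx' : x ∉ closure (A g') := fun hx' ↦
          hgg (hA_disj _ _ x (hA_closed g' x hx.1 hx') hx)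
        filter_upwards [isClosed_closure.isOpen_compl.mem_nhds hx'] with y hy hy'
        exact (hy (subset_closure hy')).elim
    filter_upwards [Filter.eventually_all.2 this, hW.mem_nhds hx.1] with y hy hyW
    obtain ⟨g', hg'⟩ := hA_cover y hyW
    exact hy g' hg' ▸ hg'
  rcases W.eq_empty_or_nonempty with rfl | ⟨x, hx⟩
  · exact ⟨1, L.group.one_mem, fun x hx ↦ hx.elim⟩
  · obtain ⟨g, hg⟩ := hA_cover x hx
    have := hWc.subset_of_closure_inter_subset (hA_open g) ⟨x, hx, hg⟩
      fun y hy ↦ hA_closed g y hy.2 hy.1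
    exact ⟨g, g.2, fun y hy ↦ (this hy).2.1⟩

end LUS

end Rigidity

/-! ### Lifts between local uniformizing systems -/

section Lifts

variable {M : Type u} [TopologicalSpace M]

/-- `l` is a smooth map on `W` that lifts the map `φ` of `L₁` to `L`. -/
structure IsLift (L₁ L : LUS M) (W : Set (E L₁.dim)) (l : E L₁.dim → E L.dim) : Prop where
  smooth : ContDiffOn ℝ ∞ l W
  mapsTo : Set.MapsTo l W L.dom
  eq : ∀ x ∈ W, L.ψ (l x) = L₁.ψ x

/-- The domain of `L` is convex, and its group has a common fixed point. -/
def LUS.Centered (L : LUS M) : Prop :=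
  Convex ℝ (L.dom : Set (E L.dim)) ∧ ∃ c ∈ L.dom, ∀ g ∈ L.group, act g c = c

/-- The map of `L` is a plot through which all plots lift locally. -/
abbrev LUS.IsChart [DiffeologicalSpace M] (L : LUS M) : Prop :=
  Orbi.IsChart (L.dom : Set (E L.dim)) L.ψ

variable {L₁ L : LUS M} {W : Set (E L₁.dim)} {l : E L₁.dim → E L.dim}

namespace IsLift

lemma mono (h : IsLift L₁ L W l) {V : Set (E L₁.dim)} (hV : V ⊆ W) : IsLift L₁ L V l :=
  ⟨h.smooth.mono hV, h.mapsTo.mono_left hV, fun x hx ↦ h.eq x (hV hx)⟩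

lemma act_comp (h : IsLift L₁ L W l) {g : Equiv.Perm L.dom} (hg : g ∈ L.group) :
    IsLift L₁ L W (act g ∘ l) :=
  ⟨(L.contDiffOn_act hg).comp h.smooth h.mapsTo, fun _ hx ↦ act_mem g (h.mapsTo hx),
    fun x hx ↦ (L.ψ_act hg (h.mapsTo hx)).trans (h.eq x hx)⟩

lemma comp_act (h : IsLift L₁ L L₁.dom l) {g : Equiv.Perm L₁.dom} (hg : g ∈ L₁.group) :
    IsLift L₁ L L₁.dom (l ∘ act g) :=
  ⟨h.smooth.comp (L₁.contDiffOn_act hg) fun _ hx ↦ act_mem g hx,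
    fun _ hx ↦ h.mapsTo (act_mem g hx),
    fun _ hx ↦ (h.eq _ (act_mem g hx)).trans (L₁.ψ_act hg hx)⟩

lemma congr (h : IsLift L₁ L W l) {l' : E L₁.dim → E L.dim} (hl : Set.EqOn l' l W) :
    IsLift L₁ L W l' :=
  ⟨h.smooth.congr hl, fun _ hx ↦ hl hx ▸ h.mapsTo hx, fun x hx ↦ hl hx ▸ h.eq x hx⟩

lemma of_local (h : ∀ x ∈ W, ∃ V, IsOpen V ∧ x ∈ V ∧ IsLift L₁ L V l) : IsLift L₁ L W l := by
  refine ⟨fun x hx ↦ ?_, fun x hx ↦ ?_, fun x hx ↦ ?_⟩ <;> obtain ⟨V, hV, hxV, H⟩ := h x hx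
  · exact ((H.smooth x hxV).contDiffAt (hV.mem_nhds hxV)).contDiffWithinAt
  · exact H.mapsTo hxV
  · exact H.eq x hxV

lemma differentiableAt (h : IsLift L₁ L W l) (hW : IsOpen W) {x : E L₁.dim} (hx : x ∈ W) :
    DifferentiableAt ℝ l x :=
  (h.smooth.contDiffAt (hW.mem_nhds hx)).differentiableAt (by simp)

lemma comp {L₂ : LUS M} {l' : E L.dim → E L₂.dim} {V : Set (E L.dim)} (h' : IsLift L L₂ V l')
    (h : IsLift L₁ L W l) (hWV : Set.MapsTo l W V) : IsLift L₁ L₂ W (l' ∘ l) :=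
  ⟨h'.smooth.comp h.smooth hWV, fun _ hx ↦ h'.mapsTo (hWV hx),
    fun x hx ↦ (h'.eq _ (hWV hx)).trans (h.eq x hx)⟩

variable (L) in
lemma id : IsLift L L L.dom id := ⟨contDiffOn_id, fun _ hx ↦ hx, fun _ _ ↦ rfl⟩

variable (L) in
lemma exists_act_eqOn_self {V : Set (E L.dim)} (hV : IsOpen V) (hVc : IsPreconnected V)
    (hVL : V ⊆ L.dom) {s : E L.dim → E L.dim} (hs : IsLift L L V s) :
    ∃ g ∈ L.group, ∀ x ∈ V, s x = act g x :=
  L.exists_act_eqOn hV hVc (s := _root_.id) contDiffOn_id hs.smooth hVL hs.mapsTo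
    (fun x hx ↦ (hs.eq x hx).symm) fun x _ ↦ by
      rw [fderiv_id]; exact Function.surjective_id

variable [DiffeologicalSpace M]

/-- The chart property of `L₁` gives a lift κ₀ of the map of `L` with κ₀ (l x) = x. Then l ∘ κ₀
lifts the map of `L` to `L` itself, so it is an element g of the group near l x, and κ₀ ∘ g⁻¹ is a
right inverse of `l`. -/
lemma exists_local_inverse (h : IsLift L₁ L W l) (h₁ : L₁.IsChart) (hL : L.IsChart)
    (hW : IsOpen W) (hWL : W ⊆ L₁.dom) {x : E L₁.dim} (hx : x ∈ W) :
    ∃ (V : Set (E L.dim)) (κ : E L.dim → E L₁.dim), IsOpen V ∧ l x ∈ V ∧ V ⊆ L.dom ∧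
      Set.MapsTo κ V W ∧ IsLift L L₁ V κ ∧ κ (l x) = x ∧ ∀ y ∈ V, l (κ y) = y := by
  obtain ⟨V₀, κ₀, hV₀, hxV₀, hV₀L, hκ₀, hκ₀L, hκ₀ψ, hκ₀x⟩ :=
    h₁.lift_plotOn L.dom.isOpen hL.plotOn (h.mapsTo hx) (hWL hx) (h.eq x hx)
  have hκ₀lift : IsLift L L₁ V₀ κ₀ := ⟨hκ₀, hκ₀L, hκ₀ψ⟩
  obtain ⟨ε, hε, hb⟩ := Metric.isOpen_iff.1 (hκ₀.continuousOn.isOpen_inter_preimage hV₀ hW) (l x)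
    ⟨hxV₀, by rwa [Set.mem_preimage, hκ₀x]⟩
  have hbV : Metric.ball (l x) ε ⊆ V₀ := fun y hy ↦ (hb hy).1
  have hlκ : IsLift L L (Metric.ball (l x) ε) (l ∘ κ₀) :=
    h.comp (hκ₀lift.mono hbV) fun y hy ↦ (hb hy).2
  obtain ⟨g, hg, hgl⟩ := exists_act_eqOn_self L Metric.isOpen_ball
    (convex_ball _ _).isPreconnected (hbV.trans hV₀L) hlκ
  have hgx : act g (l x) = l x := by
    rw [← hgl _ (Metric.mem_ball_self hε), Function.comp, hκ₀x]
  have hgx' : act g⁻¹ (l x) = l x := by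
    conv_lhs => rw [← hgx]
    exact act_inv_act g _
  have hg' := L.group.inv_mem hg
  refine ⟨L.dom ∩ act g⁻¹ ⁻¹' Metric.ball (l x) ε, κ₀ ∘ act g⁻¹,
    (L.contDiffOn_act hg').continuousOn.isOpen_inter_preimage L.dom.isOpen Metric.isOpen_ball,
    ⟨h.mapsTo hx, ?_⟩, Set.inter_subset_left, fun y hy ↦ (hb hy.2).2, ?_, ?_, fun y hy ↦ ?_⟩
  · rw [Set.mem_preimage, hgx']
    exact Metric.mem_ball_self hε
  · exact hκ₀lift.comp (((IsLift.id L).act_comp hg').mono Set.inter_subset_left)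
      fun y hy ↦ hbV hy.2
  · rw [Function.comp, hgx', hκ₀x]
  · exact (hgl _ hy.2).trans (act_act_inv g y)

/-- Surjectivity comes from l ∘ κ = id. For injectivity, κ ∘ l is a lift of `L₁` to itself, hence a
group element near x, whose derivative is invertible. Equality of the two dimensions is a
consequence, not an assumption. -/
lemma bijective_fderiv (h : IsLift L₁ L W l) (h₁ : L₁.IsChart) (hL : L.IsChart)
    (hW : IsOpen W) (hWL : W ⊆ L₁.dom) {x : E L₁.dim} (hx : x ∈ W) :
    Function.Bijective (fderiv ℝ l x) := by
  obtain ⟨V, κ, hV, hxV, hVL, hκW, hκ, hκx, hlκ⟩ := h.exists_local_inverse h₁ hL hW hWL hx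
  have hdl := h.differentiableAt hW hx
  have hdκ := hκ.differentiableAt hV hxV
  constructor
  · obtain ⟨ε, hε, hb⟩ := Metric.isOpen_iff.1
      (h.smooth.continuousOn.isOpen_inter_preimage hW hV) x ⟨hx, hxV⟩
    have hbW : Metric.ball x ε ⊆ W := fun y hy ↦ (hb hy).1
    obtain ⟨g, hg, hgl⟩ := exists_act_eqOn_self L₁ Metric.isOpen_ball
      (convex_ball x ε).isPreconnected (hbW.trans hWL)
      (hκ.comp (h.mono hbW) fun y hy ↦ (hb hy).2)
    have h2 : (fderiv ℝ κ (l x)).comp (fderiv ℝ l x) = fderiv ℝ (act g) x := by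
      rw [← fderiv_comp x hdκ hdl]
      refine Filter.EventuallyEq.fderiv_eq ?_
      filter_upwards [Metric.ball_mem_nhds x hε] with y hy using hgl y hy
    have h3 : ((fderiv ℝ (act g⁻¹) (act g x)).comp (fderiv ℝ (act g) x))
        = ContinuousLinearMap.id ℝ _ := by
      rw [← L₁.fderiv_act_mul (L₁.group.inv_mem hg) hg (hWL hx), inv_mul_cancel,
        L₁.fderiv_act_one]
    rw [← h2] at h3
    exact Function.LeftInverse.injective
      (g := (fderiv ℝ (act g⁻¹) (act g x)).comp (fderiv ℝ κ (l x))) fun v ↦ DFunLike.congr_fun h3 v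
  · have h2 : (fderiv ℝ l x).comp (fderiv ℝ κ (l x)) = ContinuousLinearMap.id ℝ _ := by
      rw [← fderiv_id (𝕜 := ℝ) (x := l x)]
      have := fderiv_comp (𝕜 := ℝ) (g := l) (f := κ) (l x) (by rwa [hκx]) hdκ
      rw [hκx] at this
      rw [← this]
      refine Filter.EventuallyEq.fderiv_eq ?_
      filter_upwards [hV.mem_nhds hxV] with y hy using hlκ y hy
    exact fun v ↦ ⟨_, DFunLike.congr_fun h2 v⟩

lemma exists_act_eqOn (h : IsLift L₁ L W l) (h₁ : L₁.IsChart) (hL : L.IsChart)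
    (hW : IsOpen W) (hWc : IsPreconnected W) (hWL : W ⊆ L₁.dom) {l' : E L₁.dim → E L.dim}
    (h' : IsLift L₁ L W l') : ∃ g ∈ L.group, ∀ x ∈ W, l' x = act g (l x) :=
  L.exists_act_eqOn hW hWc h.smooth h'.smooth h.mapsTo h'.mapsTo
    (fun x hx ↦ (h.eq x hx).trans (h'.eq x hx).symm)
    fun _ hx ↦ (h.bijective_fderiv h₁ hL hW hWL hx).2

/-- Since `l` covers a neighbourhood of `l x`, the two elements agree on an open set. -/
lemma eq_of_act_comp (h : IsLift L₁ L W l) (h₁ : L₁.IsChart) (hL : L.IsChart)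
    (hW : IsOpen W) (hWL : W ⊆ L₁.dom) {x : E L₁.dim} (hx : x ∈ W)
    {g g' : Equiv.Perm L.dom} (hg : g ∈ L.group) (hg' : g' ∈ L.group)
    (H : ∀ᶠ y in 𝓝 x, act g (l y) = act g' (l y)) : g = g' := by
  obtain ⟨V, κ, hV, hxV, hVL, hκW, hκ, hκx, hlκ⟩ := h.exists_local_inverse h₁ hL hW hWL hx
  refine L.eq_of_act_eventuallyEq hg hg' (h.mapsTo hx) ?_
  have ht : Filter.Tendsto κ (𝓝 (l x)) (𝓝 x) := by
    have := (hκ.differentiableAt hV hxV).continuousAt.tendsto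
    rwa [hκx] at this
  filter_upwards [ht.eventually H, hV.mem_nhds hxV] with y hy hyV
  rwa [hlκ y hyV] at hy

lemma eqOn_of_eventuallyEq (h : IsLift L₁ L W l) (h₁ : L₁.IsChart) (hL : L.IsChart)
    (hW : IsOpen W) (hWc : IsPreconnected W) (hWL : W ⊆ L₁.dom) {l' : E L₁.dim → E L.dim}
    (h' : IsLift L₁ L W l') {x : E L₁.dim} (hx : x ∈ W) (H : l' =ᶠ[𝓝 x] l) :
    Set.EqOn l' l W := by
  obtain ⟨g, hg, hgl⟩ := h.exists_act_eqOn h₁ hL hW hWc hWL h'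
  have : g = 1 := by
    refine h.eq_of_act_comp h₁ hL hW hWL hx hg L.group.one_mem ?_
    filter_upwards [H, hW.mem_nhds hx] with y hy hyW
    rw [act_one, ← hgl y hyW, hy]
  intro y hy
  rw [hgl y hy, this, act_one]

lemma exists_equivariant (h : IsLift L₁ L L₁.dom l) (h₁ : L₁.IsChart) (hL : L.IsChart)
    {g : Equiv.Perm L₁.dom} (hg : g ∈ L₁.group) :
    ∃ k ∈ L.group, ∀ x ∈ L₁.dom, l (act g x) = act k (l x) :=
  h.exists_act_eqOn h₁ hL L₁.dom.isOpen L₁.connected.isPreconnected subset_rfl (h.comp_act hg)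

/-- The isotropy group of `l x` comes from the isotropy group of `x`. -/
lemma exists_of_stab (h : IsLift L₁ L L₁.dom l) (h₁ : L₁.IsChart) (hL : L.IsChart)
    {x : E L₁.dim} (hx : x ∈ L₁.dom) {k : Equiv.Perm L.dom} (hk : k ∈ L.group)
    (hkx : act k (l x) = l x) :
    ∃ g ∈ L₁.group, act g x = x ∧ ∀ y ∈ L₁.dom, l (act g y) = act k (l y) := by
  obtain ⟨V, κ, hV, hxV, hVL, hκW, hκ, hκx, hlκ⟩ :=
    h.exists_local_inverse h₁ hL L₁.dom.isOpen subset_rfl hx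
  have hkl := h.act_comp hk
  obtain ⟨ε, hε, hb⟩ := Metric.isOpen_iff.1
    (hkl.smooth.continuousOn.isOpen_inter_preimage L₁.dom.isOpen hV) x
    ⟨hx, by rwa [Set.mem_preimage, Function.comp, hkx]⟩
  have hbW : Metric.ball x ε ⊆ L₁.dom := fun y hy ↦ (hb hy).1
  -- Near x, the map κ ∘ k ∘ l is a lift of `L₁` to itself, which yields g. The identity l ∘ g = k ∘
  -- l then spreads from a ball to the connected domain.
  obtain ⟨g, hg, hgl⟩ := exists_act_eqOn_self L₁ Metric.isOpen_ball
    (convex_ball x ε).isPreconnected hbW (hκ.comp (hkl.mono hbW) fun y hy ↦ (hb hy).2)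
  refine ⟨g, hg, ?_, ?_⟩
  · rw [← hgl x (Metric.mem_ball_self hε), Function.comp, Function.comp, hkx, hκx]
  · refine hkl.eqOn_of_eventuallyEq h₁ hL L₁.dom.isOpen L₁.connected.isPreconnected subset_rfl
      (h.comp_act hg) hx ?_
    filter_upwards [Metric.ball_mem_nhds x hε] with y hy
    rw [Function.comp, ← hgl y hy]
    exact hlκ _ (hb hy).2

lemma isOpen_image (h : IsLift L₁ L L₁.dom l) (h₁ : L₁.IsChart) (hL : L.IsChart) :
    IsOpen (l '' L₁.dom) := by
  rw [isOpen_iff_mem_nhds]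
  rintro _ ⟨x, hx, rfl⟩
  obtain ⟨V, κ, hV, hxV, hVL, hκW, hκ, hκx, hlκ⟩ :=
    h.exists_local_inverse h₁ hL L₁.dom.isOpen subset_rfl hx
  filter_upwards [hV.mem_nhds hxV] with y hy using ⟨κ y, hκW hy, hlκ y hy⟩

lemma exists_inverse (h : IsLift L₁ L L₁.dom l) (h₁ : L₁.IsChart) (hL : L.IsChart)
    (hinj : Set.InjOn l L₁.dom) :
    ∃ μ : E L.dim → E L₁.dim, ContDiffOn ℝ ∞ μ (l '' L₁.dom) ∧ ∀ x ∈ L₁.dom, μ (l x) = x := by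
  have hμ : ∀ x ∈ L₁.dom, Function.invFunOn l L₁.dom (l x) = x :=
    hinj.leftInvOn_invFunOn
  refine ⟨Function.invFunOn l L₁.dom, ?_, hμ⟩
  rintro _ ⟨x, hx, rfl⟩
  obtain ⟨V, κ, hV, hxV, hVL, hκW, hκ, hκx, hlκ⟩ :=
    h.exists_local_inverse h₁ hL L₁.dom.isOpen subset_rfl hx
  refine ContDiffAt.contDiffWithinAt ?_
  refine (hκ.smooth.contDiffAt (hV.mem_nhds hxV)).congr_of_eventuallyEq ?_
  filter_upwards [hV.mem_nhds hxV] with y hy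
  conv_lhs => rw [← hlκ y hy]
  exact hμ _ (hκW hy)

/-- A lift defined on the whole domain of a centered system is injective. -/
lemma injOn (h : IsLift L₁ L L₁.dom l) (h₁ : L₁.IsChart) (hL : L.IsChart)
    (hc : L₁.Centered) : Set.InjOn l L₁.dom := by
  -- At the common fixed point c, the relation l ∘ g = l gives dl ∘ dg = dl with dl injective, so dg
  -- = id and g = 1. Without a fixed point this fails: `l` may be a nontrivial covering.
  have key : ∀ g ∈ L₁.group, (∀ x ∈ L₁.dom, l (act g x) = l x) → g = 1 := by
    intro g hg H
    obtain ⟨-, c, hcU, hcg⟩ := hc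
    have hd : Function.Bijective (fderiv ℝ l c) :=
      h.bijective_fderiv h₁ hL L₁.dom.isOpen subset_rfl hcU
    refine L₁.eq_one_of_fderiv_act hg hcU (hcg g hg) ?_
    have hda := (L₁.contDiffAt_act hg hcU).differentiableAt (by simp)
    have h1 := fderiv_comp (𝕜 := ℝ) (g := l) c
      (by rw [hcg g hg]; exact h.differentiableAt L₁.dom.isOpen hcU) hda
    rw [hcg g hg] at h1
    have h2 : fderiv ℝ (l ∘ act g) c = fderiv ℝ l c := by
      refine Filter.EventuallyEq.fderiv_eq ?_
      filter_upwards [L₁.dom.isOpen.mem_nhds hcU] with y hy using H y hy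
    ext1 v
    refine hd.1 ?_
    rw [h2] at h1
    exact (DFunLike.congr_fun h1 v).symm
  intro x hx y hy hxy
  obtain ⟨g, hg, rfl⟩ := (L₁.ψ_eq_iff hx hy).1 (by rw [← h.eq x hx, ← h.eq y hy, hxy])
  -- With y = g x and l x = l y, the element k induced by g fixes l x, so k is also induced by some
  -- g' fixing x. By `key`, g = g', and therefore y = x.
  obtain ⟨k, hk, hkl⟩ := h.exists_equivariant h₁ hL hg
  obtain ⟨g', hg', hgx', hgl'⟩ := h.exists_of_stab h₁ hL hx hk (by rw [← hkl x hx, ← hxy])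
  have : g'⁻¹ * g = 1 := by
    refine key _ (L₁.group.mul_mem (L₁.group.inv_mem hg') hg) fun z hz ↦ ?_
    obtain ⟨k', hk', hkl'⟩ := h.exists_equivariant h₁ hL (L₁.group.inv_mem hg')
    have e1 : ∀ w ∈ L₁.dom, act k' (act k (l w)) = l w := fun w hw ↦ by
      rw [← hgl' w hw, ← hkl' _ (act_mem g' hw), act_inv_act]
    rw [act_mul, hkl' _ (act_mem g hz), hkl z hz, e1 z hz]
  rw [(inv_mul_eq_one.1 this).symm, hgx']

lemma isInjection (h : IsLift L₁ L L₁.dom l) (h₁ : L₁.IsChart) (hL : L.IsChart)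
    (hinj : Set.InjOn l L₁.dom) :
    IsInjection L₁ L fun x ↦ ⟨l x, h.mapsTo x.2⟩ := by
  have hr : Set.range (fun x : L₁.dom ↦ l x) = l '' L₁.dom := by
    rw [Set.image_eq_range]; rfl
  obtain ⟨μ, hμ, hμl⟩ := h.exists_inverse h₁ hL hinj
  refine ⟨⟨l, h.smooth, fun _ ↦ rfl⟩, ?_, ⟨μ, ?_, fun x ↦ hμl x x.2⟩, ?_⟩
  · simp only [hr]
    exact h.isOpen_image h₁ hL
  · simp only [hr]
    exact hμ
  · ext x
    simp only [Function.comp]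
    rw [← L₁.ψ_coe x, ← h.eq x x.2, L.ψ_apply]

end IsLift

lemma IsInjection.exists_isLift {f : L₁.dom → L.dom} (h : IsInjection L₁ L f) :
    ∃ l, IsLift L₁ L L₁.dom l ∧ IsOpen (l '' L₁.dom) ∧ ∃ μ : E L.dim → E L₁.dim,
      ContDiffOn ℝ ∞ μ (l '' L₁.dom) ∧ ∀ x ∈ L₁.dom, μ (l x) = x := by
  obtain ⟨⟨F, hF, hFf⟩, ho, ⟨μ, hμ, hμf⟩, he⟩ := h
  have hFf' : ∀ x (hx : x ∈ L₁.dom), F x = f ⟨x, hx⟩ := fun x hx ↦ hFf ⟨x, hx⟩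
  have hr : Set.range (fun x : L₁.dom ↦ (f x : E L.dim)) = F '' L₁.dom := by
    rw [Set.image_eq_range]
    exact congrArg Set.range (funext fun x ↦ (hFf x).symm)
  rw [hr] at ho hμ
  refine ⟨F, ⟨hF, fun x hx ↦ ?_, fun x hx ↦ ?_⟩, ho, μ, hμ, fun x hx ↦ ?_⟩
  · rw [hFf' x hx]
    exact (f ⟨x, hx⟩).2
  · rw [hFf' x hx, L.ψ_coe, L₁.ψ_apply hx, he]
    rfl
  · rw [hFf' x hx]
    exact hμf ⟨x, hx⟩

end Lifts

/-! ### Global lifts, by continuation along segments and by factorization -/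

section GlobalLift

variable {M : Type u} [TopologicalSpace M] {L₁ L : LUS M}

namespace IsLift

lemma exists_union {V V' : Set (E L₁.dim)} (hV : IsOpen V) (hV' : IsOpen V')
    {l l' : E L₁.dim → E L.dim} (h : IsLift L₁ L V l) (h' : IsLift L₁ L V' l')
    (H : Set.EqOn l l' (V ∩ V')) :
    ∃ l'', IsLift L₁ L (V ∪ V') l'' ∧ Set.EqOn l'' l V := by
  classical
  have e : Set.EqOn (V.piecewise l l') l V := Set.piecewise_eqOn V l l'
  have e' : Set.EqOn (V.piecewise l l') l' V' := fun x hx ↦ by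
    by_cases hxV : x ∈ V
    · rw [e hxV, H ⟨hxV, hx⟩]
    · exact Set.piecewise_eqOn_compl V l l' hxV
  refine ⟨V.piecewise l l', of_local fun x hx ↦ ?_, e⟩
  rcases hx with hx | hx
  · exact ⟨V, hV, hx, h.congr e⟩
  · exact ⟨V', hV', hx, h'.congr e'⟩

variable [DiffeologicalSpace M]

lemma exists_ball (h₁ : L₁.IsChart) (hL : L.IsChart) (hr : Set.range L₁.φ ⊆ Set.range L.φ)
    {x : E L₁.dim} (hx : x ∈ L₁.dom) :
    ∃ ε > 0, Metric.ball x ε ⊆ L₁.dom ∧ ∃ l, IsLift L₁ L (Metric.ball x ε) l := by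
  have : L₁.ψ x ∈ L.ψ '' L.dom := by
    rw [L.image_ψ]
    exact hr (L₁.ψ_mem_range hx)
  obtain ⟨z, hz, hzx⟩ := this
  obtain ⟨W, s, hW, hxW, hWL, hs, hsU, hsψ, -⟩ :=
    hL.lift_plotOn L₁.dom.isOpen h₁.plotOn hx hz hzx.symm
  obtain ⟨ε, hε, hb⟩ := Metric.isOpen_iff.1 hW x hxW
  exact ⟨ε, hε, hb.trans hWL, s, IsLift.mono ⟨hs, hsU, hsψ⟩ hb⟩

/-- The map of a system with convex domain lifts globally. -/
lemma exists_of_convex (h₁ : L₁.IsChart) (hL : L.IsChart)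
    (hr : Set.range L₁.φ ⊆ Set.range L.φ) (hconv : Convex ℝ (L₁.dom : Set (E L₁.dim))) :
    ∃ l, IsLift L₁ L L₁.dom l := by
  obtain ⟨c, hc⟩ := L₁.connected.nonempty
  obtain ⟨ε₀, hε₀, hb₀, l₀, hl₀⟩ := exists_ball h₁ hL hr hc
  -- Convexity of W keeps intersections connected, and fixing the germ at c makes any two such lifts
  -- agree where both are defined.
  let Good (x : E L₁.dim) (W : Set (E L₁.dim)) (l : E L₁.dim → E L.dim) : Prop :=
    IsOpen W ∧ Convex ℝ W ∧ W ⊆ L₁.dom ∧ c ∈ W ∧ x ∈ W ∧ IsLift L₁ L W l ∧ l =ᶠ[𝓝 c] l₀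
  have key : ∀ x ∈ L₁.dom, ∃ W l, Good x W l := by
    intro x hx
    let γ : ℝ → E L₁.dim := AffineMap.lineMap c x
    have hγ : Continuous γ := AffineMap.lineMap_continuous
    let u : Set ℝ := {t | ∃ W l, Good (γ t) W l}
    have hu : IsOpen u := by
      rw [isOpen_iff_mem_nhds]
      rintro t ⟨W, l, hW, hWc, hWL, hcW, hxW, hl⟩
      filter_upwards [(hW.preimage hγ).mem_nhds hxW] with t' ht'
      exact ⟨W, l, hW, hWc, hWL, hcW, ht', hl⟩
    have h0 : (0 : ℝ) ∈ u :=
      ⟨Metric.ball c ε₀, l₀, Metric.isOpen_ball, convex_ball _ _, hb₀, Metric.mem_ball_self hε₀,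
        by simp [γ, hε₀], hl₀, Filter.EventuallyEq.rfl⟩
    have hcl : closure u ∩ Set.Icc 0 1 ⊆ u := by
      rintro t ⟨htu, ht0, ht1⟩
      have hγt : γ t ∈ L₁.dom := hconv.lineMap_mem hc hx ⟨ht0, ht1⟩
      obtain ⟨ε, hε, hb, lb, hlb⟩ := exists_ball h₁ hL hr hγt
      obtain ⟨η, hη, hηb⟩ := Metric.continuous_iff.1 hγ t (ε / 2) (half_pos hε)
      obtain ⟨t', ⟨W', l', hW', hWc', hWL', hcW', hxW', hl', hle⟩, htt'⟩ :=
        Metric.mem_closure_iff.1 htu η hη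
      have hK : IsCompact (segment ℝ c (γ t')) := by
        rw [segment_eq_image_lineMap]
        exact isCompact_Icc.image AffineMap.lineMap_continuous
      obtain ⟨δ, hδ, hδW⟩ := hK.exists_thickening_subset_open hW'
        (hWc'.segment_subset hcW' hxW')
      have hball' : γ t' ∈ Metric.ball (γ t) ε := by
        rw [Metric.mem_ball]
        exact (hηb t' (by rwa [dist_comm])).trans (half_lt_self hε)
      -- The lift on the ball around the limit point is moved by a group element to match the lift
      -- already constructed, and the two are glued.
      obtain ⟨g, hg, hgl⟩ := (hlb.mono Set.inter_subset_right).exists_act_eqOn h₁ hL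
        (hW'.inter Metric.isOpen_ball) (hWc'.inter (convex_ball (γ t) ε)).isPreconnected
        (Set.inter_subset_left.trans hWL') (hl'.mono Set.inter_subset_left)
      obtain ⟨l, hl, hll'⟩ := hl'.exists_union hW' Metric.isOpen_ball (hlb.act_comp hg)
        fun y hy ↦ hgl y hy
      -- The union need not be convex, but a thin tube around the segment from c to γ t is. Points
      -- of the segment with parameter at most t' have their neighbourhood in W', and the remaining
      -- ones lie within ε/2 of γ t.
      have hsub : Metric.thickening (min δ (ε / 2)) (segment ℝ c (γ t)) ⊆
          W' ∪ Metric.ball (γ t) ε := by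
        intro y hy
        obtain ⟨z, hz, hyz⟩ := Metric.mem_thickening_iff.1 hy
        have hz' : ∃ s ∈ Set.Icc (0 : ℝ) t, γ s = z := by
          rw [segment_eq_image_lineMap] at hz
          obtain ⟨s, hs, rfl⟩ := hz
          refine ⟨t * s, ⟨mul_nonneg ht0 hs.1, mul_le_of_le_one_right ht0 hs.2⟩, ?_⟩
          simp only [γ, AffineMap.lineMap_apply_module']
          rw [add_sub_cancel_right, smul_smul, mul_comm]
        obtain ⟨s, ⟨hs0, hst⟩, rfl⟩ := hz'
        by_cases hst' : s ≤ t'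
        · left
          refine hδW (Metric.mem_thickening_iff.2 ⟨γ s, ?_, hyz.trans_le (min_le_left _ _)⟩)
          rw [segment_eq_image_lineMap]
          rcases hs0.eq_or_lt with rfl | hs0
          · exact ⟨0, by simp, by simp [γ]⟩
          · have ht' : 0 < t' := hs0.trans_le hst'
            refine ⟨s / t', ⟨by positivity, div_le_one_of_le₀ hst' ht'.le⟩, ?_⟩
            simp only [γ, AffineMap.lineMap_apply_module']
            rw [add_sub_cancel_right, smul_smul, div_mul_cancel₀ _ ht'.ne']
        · right
          rw [Metric.mem_ball]
          have h1 : dist (γ s) (γ t) < ε / 2 := by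
            refine hηb s ?_
            rw [Real.dist_eq] at htt' ⊢
            push Not at hst'
            rw [abs_of_nonpos (by linarith)]
            rw [abs_of_nonneg (by linarith)] at htt'
            linarith
          calc dist y (γ t) ≤ dist y (γ s) + dist (γ s) (γ t) := dist_triangle _ _ _
            _ < ε / 2 + ε / 2 := add_lt_add (hyz.trans_le (min_le_right _ _)) h1
            _ = ε := add_halves ε
      have hpos : 0 < min δ (ε / 2) := lt_min hδ (half_pos hε)
      refine ⟨_, l, Metric.isOpen_thickening, (convex_segment c (γ t)).thickening _,
        hsub.trans (Set.union_subset hWL' hb),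
        Metric.self_subset_thickening hpos _ (left_mem_segment ℝ c _),
        Metric.self_subset_thickening hpos _ (right_mem_segment ℝ c _), hl.mono hsub, ?_⟩
      refine Filter.EventuallyEq.trans ?_ hle
      filter_upwards [hW'.mem_nhds hcW'] with y hy using hll' hy
    have := isPreconnected_Icc.subset_of_closure_inter_subset hu ⟨0, by simp, h0⟩ hcl
    have h1 : (1 : ℝ) ∈ u := this (by simp)
    simpa [u, γ] using h1
  choose! W l hWl using key
  refine ⟨fun x ↦ l x x, of_local fun x hx ↦ ?_⟩
  obtain ⟨hW, hWc, hWL, hcW, hxW, hl, hle⟩ := hWl x hx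
  refine ⟨W x, hW, hxW, hl.congr fun y hy ↦ ?_⟩
  obtain ⟨hV, hVc, hVL, hcV, hyV, hl', hle'⟩ := hWl y (hWL hy)
  exact (hl.mono Set.inter_subset_left).eqOn_of_eventuallyEq h₁ hL (hW.inter hV)
    (hWc.inter hVc).isPreconnected (Set.inter_subset_left.trans hWL)
    (hl'.mono Set.inter_subset_right) (x := c) ⟨hcW, hcV⟩ (hle'.trans hle.symm) ⟨hy, hyV⟩

/-- If the map of `L` lifts to `L₀`, and the image of `L` is contained in that of a centered
system `L₁` which also lifts to `L₀`, then the map of `L` lifts to `L₁`. -/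
lemma exists_of_range_subset {L₀ : LUS M} {l : E L.dim → E L₀.dim} {l₁ : E L₁.dim → E L₀.dim}
    (hl : IsLift L L₀ L.dom l) (hl₁ : IsLift L₁ L₀ L₁.dom l₁) (h₁ : L₁.IsChart)
    (h₀ : L₀.IsChart) (hc : L₁.Centered) (hr : Set.range L.φ ⊆ Set.range L₁.φ) :
    ∃ l' : E L.dim → E L₁.dim, IsLift L L₁ L.dom l' ∧ (Set.InjOn l L.dom → Set.InjOn l' L.dom) := by
  have hinj := hl₁.injOn h₁ h₀ hc
  have ho := hl₁.isOpen_image h₁ h₀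
  obtain ⟨μ, hμ, hμl⟩ := hl₁.exists_inverse h₁ h₀ hinj
  -- The points at which g ∘ l can be factored through the injective map `l₁`. These sets are open
  -- and cover the domain of `L`; two that meet coincide, so by connectedness one g serves
  -- everywhere.
  let A (g : Equiv.Perm L₀.dom) : Set (E L.dim) := {x | x ∈ L.dom ∧ act g (l x) ∈ l₁ '' L₁.dom}
  have hA_open : ∀ g ∈ L₀.group, IsOpen (A g) := fun g hg ↦
    (hl.act_comp hg).smooth.continuousOn.isOpen_inter_preimage L.dom.isOpen ho
  have hA_cover : ∀ x ∈ L.dom, ∃ g ∈ L₀.group, x ∈ A g := by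
    intro x hx
    have : L.ψ x ∈ L₁.ψ '' L₁.dom := by
      rw [L₁.image_ψ]
      exact hr (L.ψ_mem_range hx)
    obtain ⟨y, hy, hyx⟩ := this
    obtain ⟨g, hg, hgx⟩ := (L₀.ψ_eq_iff (hl.mapsTo hx) (hl₁.mapsTo hy)).1
      (by rw [hl.eq x hx, hl₁.eq y hy, hyx])
    exact ⟨g, hg, hx, y, hy, hgx.symm⟩
  have hA_trans : ∀ g ∈ L₀.group, ∀ g' ∈ L₀.group, ∀ x, x ∈ A g → x ∈ A g' → A g' ⊆ A g := by
    rintro g hg g' hg' x ⟨hx, y, hy, hyx⟩ ⟨-, y', hy', hyx'⟩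
    have hgg : g * g'⁻¹ ∈ L₀.group := L₀.group.mul_mem hg (L₀.group.inv_mem hg')
    have e1 : l₁ y = act (g * g'⁻¹) (l₁ y') := by
      rw [hyx', act_mul, act_inv_act, hyx]
    obtain ⟨h, hh, rfl⟩ := (L₁.ψ_eq_iff hy' hy).1 (by
      rw [← hl₁.eq y hy, ← hl₁.eq y' hy', e1, L₀.ψ_act hgg (hl₁.mapsTo hy')])
    -- Both k and k⁻¹ (g g'⁻¹) are induced by elements of the group of `L₁`, the latter because it
    -- fixes l₁ y'. Hence g g'⁻¹ maps the image of `l₁` into itself.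
    obtain ⟨k, hk, hkl⟩ := hl₁.exists_equivariant h₁ h₀ hh
    obtain ⟨h', hh', -, hhl'⟩ := hl₁.exists_of_stab h₁ h₀ hy'
      (k := k⁻¹ * (g * g'⁻¹)) (L₀.group.mul_mem (L₀.group.inv_mem hk) hgg) (by
        rw [act_mul, ← e1, hkl y' hy', act_inv_act])
    rintro z ⟨hz, w, hw, hwz⟩
    refine ⟨hz, act h (act h' w), act_mem _ (act_mem _ hw), ?_⟩
    rw [hkl _ (act_mem _ hw), hhl' w hw, act_mul, act_act_inv, hwz, act_mul, act_inv_act]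
  obtain ⟨x₀, hx₀⟩ := L.connected.nonempty
  obtain ⟨g, hg, hxg⟩ := hA_cover x₀ hx₀
  have hsub : (L.dom : Set (E L.dim)) ⊆ A g := by
    refine L.connected.isPreconnected.subset_of_closure_inter_subset (hA_open g hg)
      ⟨x₀, hx₀, hxg⟩ ?_
    rintro x ⟨hxc, hx⟩
    obtain ⟨g', hg', hxg'⟩ := hA_cover x hx
    obtain ⟨y, hy', hy⟩ := mem_closure_iff.1 hxc _ (hA_open g' hg') hxg'
    exact hA_trans g hg g' hg' y hy hy' hxg'
  have hlg := hl.act_comp hg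
  refine ⟨μ ∘ (act g ∘ l), ⟨hμ.comp hlg.smooth fun x hx ↦ (hsub hx).2, ?_, ?_⟩, ?_⟩
  · intro x hx
    obtain ⟨-, y, hy, hyx⟩ := hsub hx
    simp only [Function.comp]
    rwa [← hyx, hμl y hy]
  · intro x hx
    obtain ⟨-, y, hy, hyx⟩ := hsub hx
    simp only [Function.comp]
    rw [← hyx, hμl y hy, ← hl₁.eq y hy, hyx]
    exact hlg.eq x hx
  · intro hli x hx x' hx' hxx
    obtain ⟨-, y, hy, hyx⟩ := hsub hx
    obtain ⟨-, y', hy', hyx'⟩ := hsub hx'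
    simp only [Function.comp] at hxx
    rw [← hyx, ← hyx', hμl y hy, hμl y' hy'] at hxx
    refine hli hx hx' ((act g).injective ?_)
    rw [← hyx, ← hyx', hxx]

end IsLift

end GlobalLift

/-! ### Linear charts -/

section LinearQuotient

variable {n : ℕ}

lemma contDiffOn_of_plotOn {k : ℕ} {V : Set (E k)} (hV : IsOpen V) {s : E k → E n}
    (h : PlotOn V s) : ContDiffOn ℝ ∞ s V := by
  intro x hx
  obtain ⟨q, W, e, hq, hW, hxW, -, he, hqe⟩ := h.exists_isPlot hV hx
  have hq' : ContDiff ℝ ∞ q := IsContDiffCompatible.isPlot_iff.1 hq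
  exact (((hq'.comp_contDiffOn he).congr hqe).contDiffAt (hW.mem_nhds hxW)).contDiffWithinAt

variable {Γ : Subgroup (E n ≃ₗ[ℝ] E n)}

lemma mk_eq_mk_iff {x y : E n} :
    (Quotient.mk _ x : LinearQuotient Γ) = Quotient.mk _ y ↔ ∃ γ ∈ Γ, γ x = y := by
  rw [Quotient.eq, MulAction.orbitRel_apply, MulAction.mem_orbit_iff]
  constructor
  · rintro ⟨γ, rfl⟩
    refine ⟨γ⁻¹, Γ.inv_mem γ.2, ?_⟩
    exact (γ : E n ≃ₗ[ℝ] E n).symm_apply_apply y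
  · rintro ⟨γ, hγ, rfl⟩
    exact ⟨⟨γ⁻¹, Γ.inv_mem hγ⟩, γ.symm_apply_apply x⟩

lemma isPlot_mk : IsPlot (fun x ↦ Quotient.mk _ x : E n → LinearQuotient Γ) := by
  intro x _
  refine ⟨⊤, trivial, fun _ _ ↦ trivial, fun y ↦ y, fun m r hr ↦ ?_, fun _ ↦ rfl⟩
  exact IsContDiffCompatible.isPlot_iff.2 hr

lemma exists_lift_linearQuotient {k : ℕ} {V : Set (E k)} (hV : IsOpen V)
    {q : E k → LinearQuotient Γ} (hq : PlotOn V q) {x : E k} (hx : x ∈ V) :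
    ∃ (W : Set (E k)) (s : E k → E n), IsOpen W ∧ x ∈ W ∧ W ⊆ V ∧ ContDiffOn ℝ ∞ s W ∧
      ∀ y ∈ W, q y = Quotient.mk _ (s y) := by
  classical
  obtain ⟨q', W, e, hq', hW, hxW, hWV, he, hqe⟩ := hq.exists_isPlot hV hx
  obtain ⟨V', hxV', -, p, hp, hpq⟩ := hq' (e x) trivial
  let s : E k → E n := fun y ↦ if h : y ∈ V' then p ⟨y, h⟩ else 0
  have hs : ∀ y : V', s y = p y := fun y ↦ dif_pos y.2
  have hsV : ContDiffOn ℝ ∞ s V' :=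
    contDiffOn_of_plotOn V'.isOpen ((isPlotOn_iff_plotOn hs).1 hp)
  refine ⟨W ∩ e ⁻¹' V', s ∘ e, he.continuousOn.isOpen_inter_preimage hW V'.isOpen, ⟨hxW, hxV'⟩,
    fun y hy ↦ hWV hy.1, hsV.comp (he.mono Set.inter_subset_left) fun y hy ↦ hy.2, fun y hy ↦ ?_⟩
  rw [hqe hy.1]
  exact (hpq ⟨e y, hy.2⟩).trans (congrArg _ (hs ⟨e y, hy.2⟩).symm)

lemma continuous_linearEquiv (γ : E n ≃ₗ[ℝ] E n) : Continuous γ :=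
  (γ : E n →ₗ[ℝ] E n).continuous_of_finiteDimensional

lemma contDiff_linearEquiv (γ : E n ≃ₗ[ℝ] E n) : ContDiff ℝ ∞ γ :=
  (LinearMap.toContinuousLinearMap (γ : E n →ₗ[ℝ] E n)).contDiff

/-- The group need not be orthogonal, so a ball is replaced by the intersection of its preimages
under Γ. -/
lemma exists_convex_invariant [Finite Γ] {v : E n} (hv : ∀ γ ∈ Γ, γ v = v) {r : ℝ} (hr : 0 < r) :
    ∃ C : Opens (E n), Convex ℝ (C : Set (E n)) ∧ v ∈ C ∧ (C : Set (E n)) ⊆ Metric.ball v r ∧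
      ∀ γ ∈ Γ, ∀ x ∈ C, γ x ∈ C := by
  let C : Opens (E n) := ⟨⋂ γ : Γ, (γ : E n ≃ₗ[ℝ] E n) ⁻¹' Metric.ball v r,
    isOpen_iInter_of_finite fun γ ↦ Metric.isOpen_ball.preimage (continuous_linearEquiv γ.1)⟩
  have hC : ∀ x, x ∈ C ↔ ∀ γ ∈ Γ, γ x ∈ Metric.ball v r := fun x ↦ by
    change x ∈ ⋂ γ : Γ, (γ : E n ≃ₗ[ℝ] E n) ⁻¹' Metric.ball v r ↔ _
    simp
  refine ⟨C, convex_iInter fun γ ↦ ?_, (hC v).2 fun γ hγ ↦ ?_, fun x hx ↦ ?_, fun γ hγ x hx ↦ ?_⟩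
  · exact (convex_ball v r).linear_preimage (γ : E n ≃ₗ[ℝ] E n).toLinearMap
  · rw [hv γ hγ]
    exact Metric.mem_ball_self hr
  · exact (hC x).1 hx 1 Γ.one_mem
  · exact (hC _).2 fun γ' hγ' ↦ (hC x).1 hx (γ' * γ) (Γ.mul_mem hγ' hγ)

lemma dimH_submodule (F : Submodule ℝ (E n)) : dimH (F : Set (E n)) = Module.finrank ℝ F := by
  have := F.subtypeₗᵢ.isometry.dimH_image Set.univ
  rwa [Set.image_univ, Real.dimH_univ_eq_finrank, Submodule.coe_subtypeₗᵢ, Submodule.coe_subtype,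
    Subtype.range_coe] at this

lemma dimH_submodule_inter (F : Submodule ℝ (E n)) {C : Set (E n)} (hC : C ∈ 𝓝 0) :
    dimH ((F : Set (E n)) ∩ C) = Module.finrank ℝ F := by
  have := F.subtypeₗᵢ.isometry.dimH_image (F.subtypeₗᵢ ⁻¹' C)
  have hmem : F.subtypeₗᵢ ⁻¹' C ∈ 𝓝 (0 : F) :=
    F.subtypeₗᵢ.continuous.continuousAt.preimage_mem_nhds (by rwa [map_zero])
  rw [Real.dimH_of_mem_nhds hmem] at this
  rw [← this]
  congr 1
  ext x
  simp [and_comm]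

/-- The vectors fixed by a linear automorphism. -/
abbrev fixedVectors (γ : E n ≃ₗ[ℝ] E n) : Submodule ℝ (E n) :=
  LinearMap.eqLocus (γ : E n →ₗ[ℝ] E n) LinearMap.id

lemma finrank_fixedVectors_le {γ : E n ≃ₗ[ℝ] E n} (h : ¬ IsReflection γ) (h1 : γ ≠ 1) :
    Module.finrank ℝ (fixedVectors γ) + 2 ≤ n := by
  have hle : Module.finrank ℝ (fixedVectors γ) ≤ n := by
    simpa using Submodule.finrank_le (fixedVectors γ)
  have hne : Module.finrank ℝ (fixedVectors γ) ≠ n := fun he ↦ h1 <| by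
    have : fixedVectors γ = ⊤ := Submodule.eq_top_of_finrank_eq (by simpa using he)
    ext1 x
    have hx : x ∈ fixedVectors γ := this ▸ trivial
    exact hx
  have : Module.finrank ℝ (fixedVectors γ) + 1 ≠ n := h
  omega

end LinearQuotient

/-! ### Linear charts as local uniformizing systems and as orbifold charts -/

section LinearChart

variable (M : Type u) [DiffeologicalSpace M]

/-- A chart of the form `C / Γ`, where `C` is a convex open set and `Γ` is a finite linear group
without reflections that fixes a point of `C`. -/
structure LinearChart where
  dim : ℕ
  dom : Opens (E dim)
  convex : Convex ℝ (dom : Set (E dim))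
  group : Subgroup (E dim ≃ₗ[ℝ] E dim)
  finite : Finite group
  not_isReflection : ∀ γ ∈ group, ¬ IsReflection γ
  mem_dom : ∀ γ ∈ group, ∀ x ∈ dom, γ x ∈ dom
  center : E dim
  center_mem : center ∈ dom
  apply_center : ∀ γ ∈ group, γ center = center
  φ : E dim → M
  isChart : IsChart (dom : Set (E dim)) φ
  fibers : ∀ x ∈ dom, ∀ y ∈ dom, φ x = φ y ↔ ∃ γ ∈ group, γ x = y

namespace LinearChart

variable {M} (K : LinearChart M)

/-- The permutations of the domain induced by the linear group. -/
def perms : Subgroup (Equiv.Perm K.dom) where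
  carrier := {g | ∃ γ ∈ K.group, ∀ x : K.dom, (g x : E K.dim) = γ x}
  one_mem' := ⟨1, K.group.one_mem, fun _ ↦ rfl⟩
  mul_mem' := by
    rintro a b ⟨γ, hγ, ha⟩ ⟨δ, hδ, hb⟩
    exact ⟨γ * δ, K.group.mul_mem hγ hδ, fun x ↦ by
      rw [Equiv.Perm.mul_apply, ha, hb]; rfl⟩
  inv_mem' := by
    rintro a ⟨γ, hγ, ha⟩
    refine ⟨γ⁻¹, K.group.inv_mem hγ, fun x ↦ ?_⟩
    have h1 : (x : E K.dim) = γ (a⁻¹ x : K.dom) := by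
      rw [← ha]; exact congrArg Subtype.val (a.apply_symm_apply x).symm
    rw [h1]
    exact (γ.symm_apply_apply _).symm

lemma mem_perms {g : Equiv.Perm K.dom} :
    g ∈ K.perms ↔ ∃ γ ∈ K.group, ∀ x : K.dom, (g x : E K.dim) = γ x := Iff.rfl

lemma exists_perm {γ : E K.dim ≃ₗ[ℝ] E K.dim} (hγ : γ ∈ K.group) :
    ∃ g ∈ K.perms, ∀ x : K.dom, (g x : E K.dim) = γ x :=
  ⟨⟨fun x ↦ ⟨γ x, K.mem_dom γ hγ x x.2⟩,
    fun x ↦ ⟨γ⁻¹ x, K.mem_dom _ (K.group.inv_mem hγ) x x.2⟩,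
    fun x ↦ Subtype.ext (γ.symm_apply_apply x), fun x ↦ Subtype.ext (γ.apply_symm_apply x)⟩,
    ⟨γ, hγ, fun _ ↦ rfl⟩, fun _ ↦ rfl⟩

lemma finite_perms : Finite K.perms := by
  have := K.finite
  choose γ hγ h using fun g : K.perms ↦ K.mem_perms.1 g.2
  refine Finite.of_injective (fun g ↦ (⟨γ g, hγ g⟩ : K.group)) fun a b hab ↦ ?_
  have hab' : γ a = γ b := congrArg Subtype.val hab
  ext x : 3
  rw [h a x, h b x, hab']

lemma codim_perms {g : Equiv.Perm K.dom} (hg : g ∈ K.perms) (hne : g ≠ 1) :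
    CodimGE 2 ((fun x : K.dom ↦ (x : E K.dim)) '' {x | g x = x}) := by
  obtain ⟨γ, hγ, hgγ⟩ := hg
  have h1 : γ ≠ 1 := by
    rintro rfl
    exact hne (by ext x : 2; exact hgγ x)
  right
  have hsub : (fun x : K.dom ↦ (x : E K.dim)) '' {x | g x = x} ⊆ fixedVectors γ := by
    rintro _ ⟨x, hx, rfl⟩
    have h2 : γ x = x := by rw [← hgγ, hx]
    exact h2
  refine (add_le_add_left (dimH_mono hsub) _).trans ?_
  rw [dimH_submodule]
  exact_mod_cast finrank_fixedVectors_le (K.not_isReflection γ hγ) h1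

lemma mem_dom_of_mk_eq {x y : E K.dim} (hx : x ∈ K.dom)
    (h : (Quotient.mk _ x : LinearQuotient K.group) = Quotient.mk _ y) : y ∈ K.dom := by
  obtain ⟨γ, hγ, rfl⟩ := mk_eq_mk_iff.1 h
  exact K.mem_dom γ hγ x hx

lemma φ_eq_iff {x y : E K.dim} (hx : x ∈ K.dom) (hy : y ∈ K.dom) :
    K.φ x = K.φ y ↔ (Quotient.mk _ x : LinearQuotient K.group) = Quotient.mk _ y :=
  (K.fibers x hx y hy).trans mk_eq_mk_iff.symm

variable [TopologicalSpace M] [IsDTopologyCompatible M]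

lemma homeo_perms : ∃ h : Quotient (MulAction.orbitRel K.perms K.dom) ≃ₜ
    Set.range (fun x : K.dom ↦ K.φ x), ∀ x : K.dom, (h (Quotient.mk _ x) : M) = K.φ x := by
  have hrel : ∀ x y : K.dom, (MulAction.orbitRel K.perms K.dom) x y ↔ K.φ x = K.φ y := by
    intro x y
    rw [MulAction.orbitRel_apply, MulAction.mem_orbit_iff, eq_comm, K.fibers y y.2 x x.2]
    constructor
    · rintro ⟨g, hg⟩
      obtain ⟨γ, hγ, h⟩ := g.2
      exact ⟨γ, hγ, by rw [← h, ← hg]; rfl⟩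
    · rintro ⟨γ, hγ, h⟩
      obtain ⟨g, hg, hgγ⟩ := K.exists_perm hγ
      exact ⟨⟨g, hg⟩, Subtype.ext ((hgγ y).trans h)⟩
  have hcont : Continuous (fun x : K.dom ↦ K.φ x) :=
    (K.isChart.continuousOn K.dom.isOpen).comp_continuous continuous_subtype_val fun x ↦ x.2
  let f : Quotient (MulAction.orbitRel K.perms K.dom) → Set.range (fun x : K.dom ↦ K.φ x) :=
    Quotient.lift (fun x ↦ ⟨K.φ x, x, rfl⟩) fun x y h ↦ Subtype.ext ((hrel x y).1 h)
  have hf : Function.Bijective f := by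
    constructor
    · rintro ⟨x⟩ ⟨y⟩ h
      exact Quotient.sound ((hrel x y).2 (congrArg Subtype.val h))
    · rintro ⟨_, x, rfl⟩
      exact ⟨Quotient.mk _ x, rfl⟩
  have hfc : Continuous f := Continuous.quotient_lift (hcont.subtype_mk _) _
  have hfo : IsOpenMap f := by
    intro O hO
    have hO' := K.dom.isOpen.isOpenMap_subtype_val _ (hO.preimage continuous_quotient_mk')
    have := K.isChart.isOpen_image hO' (by rintro _ ⟨x, -, rfl⟩; exact x.2)
    convert this.preimage continuous_subtype_val using 1
    ext p
    constructor
    · rintro ⟨⟨x⟩, hx, rfl⟩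
      exact ⟨x, ⟨x, hx, rfl⟩, rfl⟩
    · rintro ⟨_, ⟨x, hx, rfl⟩, h⟩
      exact ⟨Quotient.mk _ x, hx, Subtype.ext h⟩
  exact ⟨(Equiv.ofBijective f hf).toHomeomorphOfContinuousOpen hfc hfo, fun _ ↦ rfl⟩

/-- The local uniformizing system given by a linear chart. -/
def toLUS : LUS M where
  dim := K.dim
  dom := K.dom
  connected := ⟨⟨K.center, K.center_mem⟩, K.convex.isPreconnected⟩
  group := K.perms
  finite := K.finite_perms
  smooth := by
    rintro g ⟨γ, -, h⟩
    exact ⟨γ, (contDiff_linearEquiv γ).contDiffOn, fun x ↦ (h x).symm⟩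
  codim := fun _ hg hne ↦ K.codim_perms hg hne
  φ := fun x ↦ K.φ x
  isOpen_range := by
    have := K.isChart.isOpen_image K.dom.isOpen subset_rfl
    rwa [Set.image_eq_range] at this
  homeo := K.homeo_perms

lemma range_toLUS : Set.range K.toLUS.φ = K.φ '' K.dom :=
  (Set.image_eq_range _ _).symm

lemma isChart_toLUS : K.toLUS.IsChart := by
  have h : Set.EqOn K.toLUS.ψ (K.φ : E K.toLUS.dim → M) (K.toLUS.dom : Set (E K.toLUS.dim)) :=
    fun x hx ↦ K.toLUS.ψ_apply hx
  refine ⟨K.isChart.plotOn.congr h, fun k q hq u z hz hqz ↦ ?_⟩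
  obtain ⟨W, s, hW, huW, hs, hsU, hsq, hsz⟩ := K.isChart.lift k q hq u z hz (hqz.trans (h hz))
  exact ⟨W, s, hW, huW, hs, hsU, fun y hy ↦ (h (hsU hy)).trans (hsq hy), hsz⟩

lemma centered_toLUS : K.toLUS.Centered := by
  refine ⟨K.convex, K.center, K.center_mem, ?_⟩
  rintro g ⟨γ, hγ, h⟩
  rw [act_apply g K.center_mem]
  exact (h ⟨K.center, K.center_mem⟩).trans (K.apply_center γ hγ)

/-- On the invariant set C, the chart and the projection to the linear quotient have the same
fibers, so they induce a bijection of their images. Plots on either side lift locally to C and can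
be pushed down the other side. -/
lemma locallyDiffeomorphicAt {p : M} (hp : p ∈ K.φ '' K.dom) :
    LocallyDiffeomorphicAt M (LinearQuotient K.group) p := by
  let π : E K.dim → LinearQuotient K.group := fun x ↦ Quotient.mk _ x
  let A : Set M := K.φ '' K.dom
  let B : Set (LinearQuotient K.group) := π '' K.dom
  let F : M → LinearQuotient K.group := fun a ↦ π (Function.invFunOn K.φ K.dom a)
  have hF : ∀ x ∈ K.dom, F (K.φ x) = π x := fun x hx ↦
    have hx' : K.φ x ∈ K.φ '' K.dom := ⟨x, hx, rfl⟩
    (K.φ_eq_iff (Function.invFunOn_mem hx') hx).1 (Function.invFunOn_eq hx')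
  have hFB : ∀ a ∈ A, F a ∈ B := by
    rintro _ ⟨x, hx, rfl⟩
    exact ⟨x, hx, (hF x hx).symm⟩
  have hbij : Function.Bijective fun a : A ↦ (⟨F a, hFB a a.2⟩ : B) := by
    constructor
    · rintro ⟨_, x, hx, rfl⟩ ⟨_, y, hy, rfl⟩ h
      have h' : F (K.φ x) = F (K.φ y) := congrArg Subtype.val h
      rw [hF x hx, hF y hy] at h'
      exact Subtype.ext ((K.φ_eq_iff hx hy).2 h')
    · rintro ⟨_, x, hx, rfl⟩
      exact ⟨⟨K.φ x, x, hx, rfl⟩, Subtype.ext (hF x hx)⟩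
  let f : A ≃ B := Equiv.ofBijective _ hbij
  have hfs : ∀ x (hx : x ∈ K.dom), (f.symm ⟨π x, x, hx, rfl⟩ : M) = K.φ x := fun x hx ↦ by
    have : f.symm ⟨π x, x, hx, rfl⟩ = ⟨K.φ x, x, hx, rfl⟩ :=
      f.symm_apply_eq.2 (Subtype.ext (hF x hx).symm)
    rw [this]
  have hA : IsOpen A := K.isChart.isOpen_image K.dom.isOpen subset_rfl
  refine ⟨A, B, f, hp, fun n q hq ↦ ?_, fun n q hq ↦ ?_⟩
  · have ho : IsOpen (q ⁻¹' A) := by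
      rw [← IsDTopologyCompatible.dTop_eq M, isOpen_iff_preimages_plots] at hA
      exact hA n q hq
    refine ⟨ho, (isPlotOn_iff_plotOn (q := F ∘ q) fun _ ↦ rfl).2 <| plotOn_of_local ?_⟩
    rintro x ⟨z, hz, hzx⟩
    obtain ⟨W, s, hW, hxW, hs, hsU, hsq, -⟩ := K.isChart.lift n q hq x z hz hzx.symm
    refine ⟨W, hW, hxW, PlotOn.mono ?_ Set.inter_subset_left⟩
    refine ((plotOn_univ.2 isPlot_mk).comp hW hs fun _ _ ↦ trivial).congr (q' := F ∘ q) ?_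
    intro y hy
    simp only [Function.comp]
    rw [← hsq hy]
    exact hF _ (hsU hy)
  · have hlift := fun x ↦ exists_lift_linearQuotient isOpen_univ (plotOn_univ.2 hq)
      (Set.mem_univ x)
    have hmem : ∀ y z, q y = π z → q y ∈ B → z ∈ K.dom := by
      rintro y z hyz ⟨w, hw, hwy⟩
      exact K.mem_dom_of_mk_eq hw (hwy.trans hyz)
    have ho : IsOpen (q ⁻¹' B) := by
      rw [isOpen_iff_mem_nhds]
      intro x hx
      obtain ⟨W, s, hW, hxW, -, hs, hsq⟩ := hlift x
      filter_upwards [(hs.continuousOn.isOpen_inter_preimage hW K.dom.isOpen).mem_nhds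
        ⟨hxW, hmem x _ (hsq x hxW) hx⟩] with y hy
      exact ⟨s y, hy.2, (hsq y hy.1).symm⟩
    let Q : E n → M := fun y ↦ open Classical in
      if h : q y ∈ B then f.symm ⟨q y, h⟩ else p
    have hQ : ∀ y (h : q y ∈ B), Q y = f.symm ⟨q y, h⟩ := fun y h ↦ dif_pos h
    refine ⟨ho, (isPlotOn_iff_plotOn (q := Q) fun y ↦ hQ y y.2).2 <| plotOn_of_local ?_⟩
    intro x hx
    obtain ⟨W, s, hW, hxW, -, hs, hsq⟩ := hlift x
    refine ⟨W, hW, hxW, ?_⟩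
    refine (K.isChart.plotOn.comp (hW.inter ho) (hs.mono Set.inter_subset_left)
      fun y hy ↦ hmem y _ (hsq y hy.1) hy.2).congr (q' := Q) ?_
    intro y hy
    have hsy := hmem y _ (hsq y hy.1) hy.2
    rw [hQ y hy.2]
    simp only [Function.comp]
    rw [← hfs _ hsy]
    congr 2
    exact Subtype.ext (hsq y hy.1)

end LinearChart

end LinearChart

/-! ### Small linear charts inside a chart -/

section Existence

variable {M : Type u} [TopologicalSpace M]

namespace LUS

/-- The isotropy representation. -/
noncomputable def isotropy (L : LUS M) {x : E L.dim} (hx : x ∈ L.dom) :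
    L.stab x →* (E L.dim ≃ₗ[ℝ] E L.dim) :=
  have key : ∀ g h : L.stab x, (fderiv ℝ (act (g * h).1) x : E L.dim →ₗ[ℝ] E L.dim) =
      (fderiv ℝ (act g.1) x : E L.dim →ₗ[ℝ] E L.dim) ∘ₗ
        (fderiv ℝ (act h.1) x : E L.dim →ₗ[ℝ] E L.dim) := fun g h ↦ by
    have := L.fderiv_act_mul g.2.1 h.2.1 hx
    rw [h.2.2] at this
    exact congrArg _ this
  have key1 : (fderiv ℝ (act (1 : L.stab x).1) x : E L.dim →ₗ[ℝ] E L.dim) = LinearMap.id := by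
    have := L.fderiv_act_one x
    exact congrArg _ this
  MonoidHom.mk' (fun g ↦ LinearEquiv.ofLinearMap (fderiv ℝ (act g.1) x : E L.dim →ₗ[ℝ] E L.dim)
    (fderiv ℝ (act (g⁻¹).1) x : E L.dim →ₗ[ℝ] E L.dim)
    (by rw [← key, mul_inv_cancel, key1]) (by rw [← key, inv_mul_cancel, key1])) fun g h ↦ by
      ext1 v
      exact LinearMap.congr_fun (key g h) v

lemma isotropy_apply (L : LUS M) {x : E L.dim} (hx : x ∈ L.dom) (g : L.stab x) (v : E L.dim) :
    L.isotropy hx g v = fderiv ℝ (act g.1) x v := rfl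

/-- Points near `x` are only identified by the isotropy group of `x`. -/
lemma exists_nhds_stab (L : LUS M) {x : E L.dim} (hx : x ∈ L.dom) :
    ∃ N ∈ 𝓝 x, ∀ g ∈ L.group, ∀ y ∈ N, act g y ∈ N → g ∈ L.stab x := by
  have := L.finite
  have h : ∀ g : L.group, ∃ N ∈ 𝓝 x, ∀ y ∈ N, act g.1 y ∈ N → g.1 ∈ L.stab x := by
    intro g
    by_cases hg : act g.1 x = x
    · exact ⟨Set.univ, Filter.univ_mem, fun _ _ _ ↦ ⟨g.2, hg⟩⟩
    · obtain ⟨U, V, hU, hV, hxU, hxV, hUV⟩ := t2_separation hg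
      refine ⟨V ∩ act g.1 ⁻¹' U, Filter.inter_mem (hV.mem_nhds hxV)
        ((L.contDiffAt_act g.2 hx).continuousAt (hU.mem_nhds hxU)), fun y hy hgy ↦ ?_⟩
      exact (Set.disjoint_left.1 hUV hy.2 hgy.1).elim
  choose N hN h using h
  exact ⟨⋂ g, N g, Filter.iInter_mem.2 hN, fun g hg y hy hgy ↦
    h ⟨g, hg⟩ y (Set.mem_iInter.1 hy _) (Set.mem_iInter.1 hgy _)⟩

variable [DiffeologicalSpace M]

/-- Every point of a chart has arbitrarily small linear charts around it. -/
lemma IsChart.exists_linearChart {L : LUS M} (hL : L.IsChart) {x : E L.dim} (hx : x ∈ L.dom)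
    {O : Set M} (hO : IsOpen O) (hxO : L.ψ x ∈ O) :
    ∃ K : LinearChart M, L.ψ x ∈ K.φ '' K.dom ∧ K.φ '' K.dom ⊆ O ∩ Set.range L.φ := by
  have := L.finite_stab x
  obtain ⟨T, hT, hTx0, hTx, hTg⟩ := L.exists_linearization hx
  have hTat : ∀ y ∈ L.dom, ContDiffAt ℝ ∞ T y := fun y hy ↦
    hT.contDiffAt (L.dom.isOpen.mem_nhds hy)
  have hs : HasStrictFDerivAt T
      ((ContinuousLinearEquiv.refl ℝ (E L.dim) : E L.dim ≃L[ℝ] E L.dim) : E L.dim →L[ℝ] E L.dim)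
      x := by
    have := (hTat x hx).hasStrictFDerivAt (by simp)
    rwa [hTx.fderiv] at this
  let e := hs.toOpenPartialHomeomorph T
  have hxe : x ∈ e.source := hs.mem_toOpenPartialHomeomorph_source
  have heT : ∀ y, e y = T y := fun _ ↦ rfl
  obtain ⟨N₀, hN₀, hN₀stab⟩ := L.exists_nhds_stab hx
  have hsource : ∀ᶠ y in 𝓝 x, ∀ g : L.stab x, act g.1 y ∈ e.source := by
    refine Filter.eventually_all.2 fun g ↦ ?_
    have := (L.contDiffAt_act g.2.1 hx).continuousAt
    refine this (e.open_source.mem_nhds ?_)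
    rwa [g.2.2]
  have hinv : ∀ᶠ y in 𝓝 x, fderiv ℝ T y ∈
      Set.range ((↑) : (E L.dim ≃L[ℝ] E L.dim) → E L.dim →L[ℝ] E L.dim) := by
    have hc : ContinuousAt (fderiv ℝ T) x :=
      (hT.continuousOn_fderiv_of_isOpen L.dom.isOpen (by simp)).continuousAt
        (L.dom.isOpen.mem_nhds hx)
    refine hc (ContinuousLinearEquiv.isOpen.mem_nhds ⟨ContinuousLinearEquiv.refl ℝ _, ?_⟩)
    rw [hTx.fderiv]
    rfl
  have hOx : L.ψ ⁻¹' O ∈ 𝓝 x :=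
    (L.continuousOn_ψ.continuousAt (L.dom.isOpen.mem_nhds hx)) (hO.mem_nhds hxO)
  obtain ⟨N, hNsub, hN, hxN⟩ := mem_nhds_iff.1 (Filter.inter_mem (Filter.inter_mem
    (Filter.inter_mem hN₀ hsource) (Filter.inter_mem hinv hOx)) (L.dom.isOpen.mem_nhds hx))
  have hN₀' : N ⊆ N₀ := fun y hy ↦ (hNsub hy).1.1.1
  have hNsource : ∀ y ∈ N, ∀ g : L.stab x, act g.1 y ∈ e.source := fun y hy ↦ (hNsub hy).1.1.2
  have hNinv : ∀ y ∈ N, ∃ A : E L.dim ≃L[ℝ] E L.dim, (A : E L.dim →L[ℝ] E L.dim) = fderiv ℝ T y :=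
    fun y hy ↦ (hNsub hy).1.2.1
  have hNO : ∀ y ∈ N, L.ψ y ∈ O := fun y hy ↦ (hNsub hy).1.2.2
  have hNL : ∀ y ∈ N, y ∈ L.dom := fun y hy ↦ (hNsub hy).2
  have hx0 : e x = 0 := hTx0
  obtain ⟨r, hr, hball⟩ := Metric.isOpen_iff.1 (e.isOpen_inter_preimage_symm hN) 0
    ⟨hx0 ▸ e.map_source hxe, by rwa [Set.mem_preimage, ← hx0, e.left_inv hxe]⟩
  have hfinΓ : Finite (L.isotropy hx).range := (Set.finite_range (L.isotropy hx)).to_subtype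
  obtain ⟨C, hCconv, h0C, hCball, hCinv⟩ :=
    exists_convex_invariant (Γ := (L.isotropy hx).range) (v := 0) (fun γ _ ↦ map_zero γ) hr
  have hCt : ∀ z ∈ C, z ∈ e.target := fun z hz ↦ (hball (hCball hz)).1
  have hCN : ∀ z ∈ C, e.symm z ∈ N := fun z hz ↦ (hball (hCball hz)).2
  have hTe : ∀ z ∈ C, T (e.symm z) = z := fun z hz ↦ e.right_inv (hCt z hz)
  have hequi : ∀ g : L.stab x, ∀ z ∈ C,
      e.symm (L.isotropy hx g z) = act g.1 (e.symm z) := by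
    intro g z hz
    have h1 := hTg g.1 g.2 _ (hNL _ (hCN z hz))
    rw [hTe z hz] at h1
    rw [isotropy_apply, ← h1, ← heT, e.left_inv (hNsource _ (hCN z hz) g)]
  have hsymm : ContDiffOn ℝ ∞ e.symm C := by
    intro z hz
    obtain ⟨A, hA⟩ := hNinv _ (hCN z hz)
    have hd := hTat _ (hNL _ (hCN z hz))
    refine (e.contDiffAt_symm (hCt z hz) (f₀' := A) ?_ hd).contDiffWithinAt
    rw [hA]
    exact (hd.differentiableAt (by simp)).hasFDerivAt
  -- The inverse of T carries the fixed vectors in C into the fixed point set of g. As T is locally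
  -- Lipschitz, that set has at least the dimension of the fixed subspace, which therefore has
  -- codimension at least two.
  have hrefl : ∀ γ ∈ (L.isotropy hx).range, ¬ IsReflection γ := by
    rintro _ ⟨g, rfl⟩ hγ
    set F := fixedVectors (L.isotropy hx g) with hF
    have hFr : Module.finrank ℝ F + 1 = L.dim := hγ
    have hg1 : (g : Equiv.Perm L.dom) ≠ 1 := by
      intro h1
      have h2 : g = 1 := Subtype.ext h1
      have h3 : F = ⊤ := by
        rw [hF, h2, map_one]
        exact eq_top_iff.2 fun v _ ↦ rfl
      rw [h3, finrank_top, finrank_euclideanSpace_fin] at hFr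
      omega
    rcases L.codim g g.2.1 hg1 with h0 | hdim
    · have : x ∈ (∅ : Set (E L.dim)) := by
        rw [← h0]
        refine ⟨⟨x, hx⟩, Subtype.ext ?_, rfl⟩
        rw [← act_apply]
        exact g.2.2
      exact this
    · have hsub : (F : Set (E L.dim)) ∩ C ⊆ T '' (e.symm '' ((F : Set (E L.dim)) ∩ C)) := by
        rintro z hz
        exact ⟨_, ⟨z, hz, rfl⟩, hTe z hz.2⟩
      have hfix : e.symm '' ((F : Set (E L.dim)) ∩ C) ⊆
          (fun x : L.dom ↦ (x : E L.dim)) '' {x | g.1 x = x} := by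
        rintro _ ⟨z, hz, rfl⟩
        have hzL := hNL _ (hCN z hz.2)
        refine ⟨⟨_, hzL⟩, Subtype.ext ?_, rfl⟩
        have h1 : L.isotropy hx g z = z := hz.1
        rw [← act_apply g.1 hzL, ← hequi g z hz.2, h1]
      have hlip : dimH (T '' (e.symm '' ((F : Set (E L.dim)) ∩ C))) ≤
          dimH (e.symm '' ((F : Set (E L.dim)) ∩ C)) := by
        refine dimH_image_le_of_locally_lipschitzOn ?_
        rintro _ ⟨z, hz, rfl⟩
        obtain ⟨c, t, ht, hlip⟩ := ((hTat _ (hNL _ (hCN z hz.2))).of_le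
          (m := 1) (by exact_mod_cast le_top)).exists_lipschitzOnWith
        exact ⟨c, t, mem_nhdsWithin_of_mem_nhds ht, hlip⟩
      have h1 := (dimH_mono hsub).trans (hlip.trans (dimH_mono hfix))
      rw [dimH_submodule_inter F (C.isOpen.mem_nhds h0C)] at h1
      have h2 := (add_le_add_left h1 _).trans hdim
      have h3 : Module.finrank ℝ F + 2 ≤ L.dim := by exact_mod_cast h2
      omega
  refine ⟨{
    dim := L.dim
    dom := C
    convex := hCconv
    group := (L.isotropy hx).range
    finite := hfinΓ
    not_isReflection := hrefl
    mem_dom := hCinv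
    center := 0
    center_mem := h0C
    apply_center := fun γ _ ↦ map_zero γ
    φ := L.ψ ∘ e.symm
    isChart := ⟨?_, ?_⟩
    fibers := ?_ }, ⟨0, h0C, ?_⟩, ?_⟩
  · exact hL.plotOn.comp C.isOpen hsymm fun z hz ↦ hNL _ (hCN z hz)
  · intro k q hq u z hz hqz
    obtain ⟨W, s, hW, huW, hs, hsU, hsq, hsz⟩ :=
      hL.lift k q hq u (e.symm z) (hNL _ (hCN z hz)) hqz
    refine ⟨W ∩ s ⁻¹' (e.source ∩ e ⁻¹' C), T ∘ s,
      hs.continuousOn.isOpen_inter_preimage hW (e.isOpen_inter_preimage C.isOpen),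
      ⟨huW, ?_⟩, hT.comp (hs.mono Set.inter_subset_left) fun y hy ↦ hsU hy.1,
      fun y hy ↦ hy.2.2, fun y hy ↦ ?_, ?_⟩
    · rw [Set.mem_preimage, hsz]
      refine ⟨e.map_target (hCt z hz), ?_⟩
      rw [Set.mem_preimage, e.right_inv (hCt z hz)]
      exact hz
    · rw [← hsq hy.1]
      exact congrArg L.ψ (e.left_inv hy.2.1)
    · rw [Function.comp, hsz, hTe z hz]
  · intro z hz z' hz'
    simp only [Function.comp]
    rw [L.ψ_eq_iff (hNL _ (hCN z hz)) (hNL _ (hCN z' hz'))]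
    constructor
    · rintro ⟨g, hg, hgz⟩
      have hgs : g ∈ L.stab x := hN₀stab g hg _ (hN₀' (hCN z hz))
        (by rw [hgz]; exact hN₀' (hCN z' hz'))
      refine ⟨_, ⟨⟨g, hgs⟩, rfl⟩, ?_⟩
      have := hTg g hgs _ (hNL _ (hCN z hz))
      rw [hgz, hTe z hz, hTe z' hz'] at this
      exact this.symm
    · rintro ⟨_, ⟨g, rfl⟩, rfl⟩
      exact ⟨g, g.2.1, (hequi g z hz).symm⟩
  · simp only [Function.comp]
    rw [← hx0, e.left_inv hxe]
  · rintro _ ⟨z, hz, rfl⟩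
    exact ⟨hNO _ (hCN z hz), L.ψ_mem_range (hNL _ (hCN z hz))⟩

end LUS

end Existence

/-! ### Linear charts of a diffeological orbifold -/

section OfOrbifold

variable {M : Type u} [DiffeologicalSpace M]

/-- Choose v over the image of x, keep only the isotropy group of v, and shrink to a convex
invariant C on which no other element of Γ identifies points. The center is v, which need not be 0.
-/
lemma LocallyDiffeomorphicAt.exists_linearChart {n : ℕ} {Γ : Subgroup (E n ≃ₗ[ℝ] E n)}
    (hfin : Finite Γ) (hrefl : ∀ γ ∈ Γ, ¬ IsReflection γ) {x : M}
    (h : LocallyDiffeomorphicAt M (LinearQuotient Γ) x) :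
    ∃ K : LinearChart M, x ∈ K.φ '' K.dom := by
  classical
  obtain ⟨A, B, f, hxA, hp, hq⟩ := h
  let π : E n → LinearQuotient Γ := fun z ↦ Quotient.mk _ z
  obtain ⟨v, hv⟩ : ∃ v, π v = f ⟨x, hxA⟩ := Quotient.exists_rep _
  obtain ⟨hB, hfs⟩ := hq n π isPlot_mk
  have hvB : v ∈ π ⁻¹' B := by
    rw [Set.mem_preimage, hv]
    exact (f ⟨x, hxA⟩).2
  let φ : E n → M := fun z ↦ if h : π z ∈ B then f.symm ⟨π z, h⟩ else x
  have hφ : ∀ z (hz : π z ∈ B), φ z = f.symm ⟨π z, hz⟩ := fun z hz ↦ dif_pos hz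
  have hsep : ∀ γ : Γ, ∃ N ∈ 𝓝 v, ∀ y ∈ N, γ.1 y ∈ N → γ.1 v = v := by
    intro γ
    by_cases hγ : γ.1 v = v
    · exact ⟨Set.univ, Filter.univ_mem, fun _ _ _ ↦ hγ⟩
    · obtain ⟨U, V, hU, hV, hxU, hxV, hUV⟩ := t2_separation hγ
      refine ⟨V ∩ γ.1 ⁻¹' U, Filter.inter_mem (hV.mem_nhds hxV)
        ((continuous_linearEquiv γ.1).continuousAt (hU.mem_nhds hxU)), fun y hy hgy ↦ ?_⟩
      exact (Set.disjoint_left.1 hUV hy.2 hgy.1).elim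
  choose N hN hNv using hsep
  obtain ⟨r, hr, hball⟩ := Metric.mem_nhds_iff.1
    (Filter.inter_mem (hB.mem_nhds hvB) (Filter.iInter_mem.2 hN))
  let Γv : Subgroup (E n ≃ₗ[ℝ] E n) := {
    carrier := {γ | γ ∈ Γ ∧ γ v = v}
    one_mem' := ⟨Γ.one_mem, rfl⟩
    mul_mem' := fun {a b} ha hb ↦ ⟨Γ.mul_mem ha.1 hb.1, by
      rw [LinearEquiv.mul_apply, hb.2, ha.2]⟩
    inv_mem' := fun {a} ha ↦ ⟨Γ.inv_mem ha.1, by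
      conv_lhs => rw [← ha.2]
      exact a.symm_apply_apply v⟩ }
  have hΓv : Finite Γv := Finite.of_injective (fun γ : Γv ↦ (⟨γ, γ.2.1⟩ : Γ)) fun a b hab ↦
    Subtype.ext (congrArg (fun γ : Γ ↦ (γ : E n ≃ₗ[ℝ] E n)) hab)
  obtain ⟨C, hCconv, hvC, hCball, hCinv⟩ :=
    exists_convex_invariant (Γ := Γv) (v := v) (fun γ hγ ↦ hγ.2) hr
  have hCB : ∀ z ∈ C, π z ∈ B := fun z hz ↦ (hball (hCball hz)).1
  have hCN : ∀ z ∈ C, ∀ γ, z ∈ N γ := fun z hz ↦ Set.mem_iInter.1 (hball (hCball hz)).2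
  refine ⟨{
    dim := n
    dom := C
    convex := hCconv
    group := Γv
    finite := hΓv
    not_isReflection := fun γ hγ ↦ hrefl γ hγ.1
    mem_dom := hCinv
    center := v
    center_mem := hvC
    apply_center := fun γ hγ ↦ hγ.2
    φ := φ
    isChart := ⟨?_, ?_⟩
    fibers := ?_ }, ⟨v, hvC, ?_⟩⟩
  · have := (isPlotOn_iff_plotOn (q := φ) (fun z : (⟨π ⁻¹' B, hB⟩ : Opens (E n)) ↦ hφ z z.2)).1 hfs
    exact this.mono hCB
  · intro k p hpp u z hz hpz
    obtain ⟨hA, hfp⟩ := hp k p hpp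
    let Q : E k → LinearQuotient Γ := fun y ↦ if h : p y ∈ A then f ⟨p y, h⟩ else π v
    have hQ : ∀ y (hy : p y ∈ A), Q y = f ⟨p y, hy⟩ := fun y hy ↦ dif_pos hy
    have hQplot := (isPlotOn_iff_plotOn (q := Q)
      (fun y : (⟨p ⁻¹' A, hA⟩ : Opens (E k)) ↦ hQ y y.2)).1 hfp
    have huA : p u ∈ A := by
      rw [hpz, hφ z (hCB z hz)]
      exact (f.symm _).2
    obtain ⟨W, s, hW, huW, hWA, hs, hsQ⟩ := exists_lift_linearQuotient hA hQplot huA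
    have hQz : Q u = π z := by
      rw [hQ u huA]
      have : (⟨p u, huA⟩ : A) = f.symm ⟨π z, hCB z hz⟩ :=
        Subtype.ext (hpz.trans (hφ z (hCB z hz)))
      rw [this, f.apply_symm_apply]
    -- The local lift s takes some value in the orbit of z; composing with γ makes it z, as the
    -- chart property demands.
    obtain ⟨γ, hγ, hγz⟩ := mk_eq_mk_iff.1 ((hsQ u huW).symm.trans hQz)
    have hγs : ContDiffOn ℝ ∞ (γ ∘ s) W := (contDiff_linearEquiv γ).comp_contDiffOn hs
    refine ⟨W ∩ (γ ∘ s) ⁻¹' C, γ ∘ s, hγs.continuousOn.isOpen_inter_preimage hW C.isOpen,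
      ⟨huW, ?_⟩, hγs.mono Set.inter_subset_left, fun y hy ↦ hy.2, fun y hy ↦ ?_, hγz⟩
    · rw [Set.mem_preimage, Function.comp, hγz]
      exact hz
    · have hyA : p y ∈ A := hWA hy.1
      have h1 : π (γ (s y)) = f ⟨p y, hyA⟩ := by
        rw [← hQ y hyA, hsQ y hy.1]
        exact (mk_eq_mk_iff.2 ⟨γ, hγ, rfl⟩).symm
      have h2 := hCB _ hy.2
      simp only [Function.comp] at h2 ⊢
      rw [hφ _ h2]
      have : (⟨π (γ (s y)), h2⟩ : B) = f ⟨p y, hyA⟩ := Subtype.ext h1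
      rw [this, f.symm_apply_apply]
  · intro z hz z' hz'
    rw [hφ z (hCB z hz), hφ z' (hCB z' hz'), Subtype.coe_inj, f.symm.injective.eq_iff,
      Subtype.mk.injEq]
    refine mk_eq_mk_iff.trans ⟨?_, ?_⟩
    · rintro ⟨γ, hγ, rfl⟩
      exact ⟨γ, ⟨hγ, hNv ⟨γ, hγ⟩ z (hCN z hz _) (hCN _ hz' _)⟩, rfl⟩
    · rintro ⟨γ, hγ, h⟩
      exact ⟨γ, hγ.1, h⟩
  · refine (hφ v hvB).trans ?_
    have : (⟨π v, hvB⟩ : B) = f ⟨x, hxA⟩ := Subtype.ext hv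
    rw [this, f.symm_apply_apply]

end OfOrbifold

/-! ### Defining families and diffeologies -/

section Generated

variable {M : Type u} [TopologicalSpace M]

/-- The diffeology generated by a set of local uniformizing systems. -/
@[reducible]
def lusDiffeology (F : Set (LUS M)) : DiffeologicalSpace M :=
  generatedDiffeology ((fun L : LUS M ↦ Parametrization.mk L.dim L.dom L.φ) '' F)

lemma isPlot_lusDiffeology_iff {F : Set (LUS M)} {n : ℕ} {q : E n → M} :
    @IsPlot M (lusDiffeology F) n q ↔ ∀ x : E n, ∃ W : Set (E n), IsOpen W ∧ x ∈ W ∧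
      ((∃ c : M, ∀ y ∈ W, q y = c) ∨ ∃ L ∈ F, ∃ s : E n → E L.dim, ContDiffOn ℝ ∞ s W ∧
        Set.MapsTo s W L.dom ∧ Set.EqOn (L.ψ ∘ s) q W) := by
  constructor
  · intro h x
    obtain ⟨W, hW, hxW, -, hc | ⟨_, ⟨L, hL, rfl⟩, s, hs, H⟩⟩ := h x trivial
    · exact ⟨W, hW, hxW, Or.inl hc⟩
    · refine ⟨W, hW, hxW, Or.inr ⟨L, hL, s, hs, fun y hy ↦ (H y hy).1, fun y hy ↦ ?_⟩⟩
      obtain ⟨h1, h2⟩ := H y hy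
      exact (L.ψ_apply h1).trans h2.symm
  · intro h x _
    obtain ⟨W, hW, hxW, hc | ⟨L, hL, s, hs, hsL, H⟩⟩ := h x
    · exact ⟨W, hW, hxW, Set.subset_univ _, Or.inl hc⟩
    · refine ⟨W, hW, hxW, Set.subset_univ _, Or.inr ⟨_, ⟨L, hL, rfl⟩, s, hs, fun y hy ↦
        ⟨hsL hy, ?_⟩⟩⟩
      exact (H hy).symm.trans (L.ψ_apply (hsL hy))

lemma plotOn_lusDiffeology {F : Set (LUS M)} {L : LUS M} (hL : L ∈ F) :
    @PlotOn M (lusDiffeology F) _ L.dom L.ψ := by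
  intro m r hr hrL
  exact isPlot_lusDiffeology_iff.2 fun x ↦ ⟨Set.univ, isOpen_univ, trivial,
    Or.inr ⟨L, hL, r, hr.contDiffOn, fun y _ ↦ hrL y, fun _ _ ↦ rfl⟩⟩

/-- The diffeology is generated by any family of charts that cover the space. -/
lemma lusDiffeology_eq [d : DiffeologicalSpace M] {F : Set (LUS M)}
    (hF : ∀ L ∈ F, L.IsChart) (hcov : ∀ p : M, ∃ L ∈ F, p ∈ Set.range L.φ) :
    lusDiffeology F = d := by
  refine DiffeologicalSpace.ext ?_
  ext n q
  rw [isPlot_lusDiffeology_iff]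
  constructor
  · intro h
    refine isPlot_of_local fun x ↦ ?_
    obtain ⟨W, hW, hxW, ⟨c, hc⟩ | ⟨L, hL, s, hs, hsL, H⟩⟩ := h x
    · refine ⟨W, hW, hxW, ?_⟩
      exact (plotOn_univ.2 (isPlot_const (x := c))).mono (Set.subset_univ W) |>.congr hc
    · exact ⟨W, hW, hxW, ((hF L hL).plotOn.comp hW hs hsL).congr H.symm⟩
  · intro h x
    obtain ⟨L, hL, hx⟩ := hcov (q x)
    rw [← L.image_ψ] at hx
    obtain ⟨z, hz, hzx⟩ := hx
    obtain ⟨W, s, hW, hxW, hs, hsL, hsq, -⟩ := (hF L hL).lift n q h x z hz hzx.symm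
    exact ⟨W, hW, hxW, Or.inr ⟨L, hL, s, hs, hsL, hsq⟩⟩

variable {F : Set (LUS M)}

lemma IsDefiningFamily.exists_mem (hF : IsDefiningFamily F) (p : M) :
    ∃ L ∈ F, p ∈ Set.range L.φ := by
  obtain ⟨_, ⟨L, hL, rfl⟩, hp⟩ := hF.covers p
  exact ⟨L, hL, hp⟩

/-- All plots of the diffeology generated by a defining family lift to its members. -/
lemma IsDefiningFamily.isChart (hF : IsDefiningFamily F) {L : LUS M} (hL : L ∈ F) :
    @LUS.IsChart M _ (lusDiffeology F) L := by
  let _ := lusDiffeology F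
  refine ⟨plotOn_lusDiffeology hL, fun k q hq u z hz hqz ↦ ?_⟩
  obtain ⟨W, hW, huW, ⟨c, hc⟩ | ⟨L', hL', s, hs, hsL, H⟩⟩ := isPlot_lusDiffeology_iff.1 hq u
  -- A locally constant plot lifts as the constant z.
  · refine ⟨W, fun _ ↦ z, hW, huW, contDiffOn_const, fun _ _ ↦ hz, fun y hy ↦ ?_, rfl⟩
    rw [hc y hy, ← hc u huW, hqz]
    rfl
  · have hu' : q u = L'.ψ (s u) := (H huW).symm
    obtain ⟨_, ⟨L₃, hL₃, rfl⟩, hp₃, hsub⟩ := hF.refines (q u) _ _ ⟨L, hL, rfl⟩ ⟨L', hL', rfl⟩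
      (hqz ▸ L.ψ_mem_range hz) (hu' ▸ L'.ψ_mem_range (hsL huW))
    rw [← L₃.image_ψ] at hp₃
    obtain ⟨w, hw, hwq⟩ := hp₃
    obtain ⟨f, hf⟩ := hF.inject L₃ hL₃ L hL fun p hp ↦ (hsub hp).1
    obtain ⟨f', hf'⟩ := hF.inject L₃ hL₃ L' hL' fun p hp ↦ (hsub hp).2
    obtain ⟨l, hl, -⟩ := hf.exists_isLift
    obtain ⟨l', hl', ho', μ, hμ, hμl⟩ := hf'.exists_isLift
    -- A member `L₃` below both systems transfers the lift: g' moves s into the image of `L₃` in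
    -- `L'`, μ pulls it back to `L₃`, l sends it to `L`, and g adjusts its value at u to z.
    obtain ⟨g', hg', hgs⟩ := (L'.ψ_eq_iff (hsL huW) (hl'.mapsTo hw)).1
      (by rw [← hu', hl'.eq w hw, hwq])
    obtain ⟨g, hg, hgz⟩ := (L.ψ_eq_iff (hl.mapsTo hw) hz).1 (by rw [hl.eq w hw, hwq, hqz])
    have hs' : ContDiffOn ℝ ∞ (act g' ∘ s) W := (L'.contDiffOn_act hg').comp hs hsL
    have hmem : u ∈ W ∩ (act g' ∘ s) ⁻¹' (l' '' L₃.dom) := ⟨huW, w, hw, hgs.symm⟩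
    have hμm : Set.MapsTo μ (l' '' L₃.dom) L₃.dom := by
      rintro _ ⟨y, hy, rfl⟩
      rwa [hμl y hy]
    refine ⟨W ∩ (act g' ∘ s) ⁻¹' (l' '' L₃.dom), act g ∘ l ∘ μ ∘ (act g' ∘ s),
      hs'.continuousOn.isOpen_inter_preimage hW ho', hmem, ?_, ?_, ?_, ?_⟩
    · refine (hl.act_comp hg).smooth.comp (hμ.comp (hs'.mono Set.inter_subset_left)
        fun y hy ↦ hy.2) fun y hy ↦ hμm hy.2
    · exact fun y hy ↦ act_mem g (hl.mapsTo (hμm hy.2))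
    · intro y hy
      have hy2 := hy.2
      obtain ⟨v, hv, hvy⟩ := hy2
      have h1 : μ ((act g' ∘ s) y) = v := by rw [← hvy, hμl v hv]
      simp only [Function.comp] at h1 hvy ⊢
      rw [h1, L.ψ_act hg (hl.mapsTo hv), hl.eq v hv, ← hl'.eq v hv, hvy,
        L'.ψ_act hg' (hsL hy.1)]
      exact H hy.1
    · simp only [Function.comp]
      rw [hgs, hμl w hw, hgz]

lemma IsDefiningFamily.dTopology_eq (hF : IsDefiningFamily F) :
    (lusDiffeology F).dTopology = ‹TopologicalSpace M› := by
  let _ := lusDiffeology F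
  ext V
  refine (isOpen_iff_preimages_plots (X := M)).trans ⟨?_, ?_⟩
  · intro h
    rw [isOpen_iff_mem_nhds]
    intro p hp
    obtain ⟨L, hL, hpL⟩ := hF.exists_mem p
    rw [← L.image_ψ] at hpL
    obtain ⟨x, hx, rfl⟩ := hpL
    obtain ⟨q, W, e, hq, hW, hxW, hWL, he, hqe⟩ :=
      (hF.isChart hL).plotOn.exists_isPlot L.dom.isOpen hx
    have ho := he.continuousOn.isOpen_inter_preimage hW (h _ q hq)
    refine Filter.mem_of_superset ((L.isOpen_image_ψ ho
      (Set.inter_subset_left.trans hWL)).mem_nhds ⟨x, ⟨hxW, ?_⟩, rfl⟩) ?_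
    · change q (e x) ∈ V
      have := hqe hxW
      simp only [Function.comp] at this
      rwa [← this]
    · rintro _ ⟨y, hy, rfl⟩
      rw [hqe hy.1]
      exact hy.2
  · intro hV n q hq
    rw [isOpen_iff_mem_nhds]
    intro u hu
    obtain ⟨L, hL, hpL⟩ := hF.exists_mem (q u)
    rw [← L.image_ψ] at hpL
    obtain ⟨x, hx, hxu⟩ := hpL
    obtain ⟨W, s, hW, huW, hs, hsL, hsq, -⟩ := (hF.isChart hL).lift n q hq u x hx hxu.symm
    have hc : ContinuousOn q W := (L.continuousOn_ψ.comp hs.continuousOn hsL).congr hsq.symm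
    exact hc.continuousAt (hW.mem_nhds huW) (hV.mem_nhds hu)

end Generated

/-! ### Families of centered charts -/

section Compatible

variable {M : Type u} [TopologicalSpace M] [DiffeologicalSpace M]

lemma LinearChart.exists_lus [IsDTopologyCompatible M] (K : LinearChart M) :
    ∃ L : LUS M, L.IsChart ∧ L.Centered ∧ Set.range L.φ = K.φ '' K.dom :=
  ⟨K.toLUS, K.isChart_toLUS, K.centered_toLUS, K.range_toLUS⟩

lemma LUS.IsChart.exists_centered [IsDTopologyCompatible M] {L : LUS M} (hL : L.IsChart) {p : M}
    (hp : p ∈ Set.range L.φ) {O : Set M} (hO : IsOpen O) (hpO : p ∈ O) :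
    ∃ K : LUS M, K.IsChart ∧ K.Centered ∧ p ∈ Set.range K.φ ∧
      Set.range K.φ ⊆ O ∩ Set.range L.φ := by
  rw [← L.image_ψ] at hp
  obtain ⟨x, hx, rfl⟩ := hp
  obtain ⟨K, hxK, hK⟩ := hL.exists_linearChart hx hO hpO
  obtain ⟨K', h1, h2, h3⟩ := K.exists_lus
  exact ⟨K', h1, h2, h3 ▸ hxK, h3 ▸ hK⟩

lemma exists_isInjection_of_centered {L₁ L : LUS M} (h₁ : L₁.IsChart) (hc : L₁.Centered)
    (hL : L.IsChart) (hr : Set.range L₁.φ ⊆ Set.range L.φ) : ∃ l, IsInjection L₁ L l := by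
  obtain ⟨l, hl⟩ := IsLift.exists_of_convex h₁ hL hr hc.1
  exact ⟨_, hl.isInjection h₁ hL (hl.injOn h₁ hL hc)⟩

variable (M) in
/-- The centered charts. -/
def centeredCharts : Set (LUS M) := {L | L.IsChart ∧ L.Centered}

/-- The centered charts whose image is contained in the image of a member of `F`. -/
def centeredBelow (F : Set (LUS M)) : Set (LUS M) :=
  {L | L ∈ centeredCharts M ∧ ∃ L' ∈ F, Set.range L.φ ⊆ Set.range L'.φ}

lemma centeredBelow_subset (F : Set (LUS M)) : centeredBelow F ⊆ centeredCharts M := fun _ h ↦ h.1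

variable [IsDTopologyCompatible M]

/-- Injections come for free between centered charts, so only a supply of small members is needed;
`hher` guarantees it. -/
lemma isDefiningFamily_of_centered {S : Set (LUS M)} (hS : S ⊆ centeredCharts M)
    (hcov : ∀ p : M, ∃ L ∈ S, p ∈ Set.range L.φ)
    (hher : ∀ L ∈ S, ∀ K ∈ centeredCharts M, Set.range K.φ ⊆ Set.range L.φ → K ∈ S) :
    IsDefiningFamily S where
  covers p := by
    obtain ⟨L, hL, hp⟩ := hcov p
    exact ⟨_, ⟨L, hL, rfl⟩, hp⟩
  refines := by
    rintro p _ _ ⟨L, hL, rfl⟩ ⟨L', -, rfl⟩ hp hp'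
    obtain ⟨K, hK, hKc, hpK, hsub⟩ := (hS hL).1.exists_centered hp L'.isOpen_range hp'
    exact ⟨_, ⟨K, hher L hL K ⟨hK, hKc⟩ fun q hq ↦ (hsub hq).2, rfl⟩, hpK,
      fun q hq ↦ ⟨(hsub hq).2, (hsub hq).1⟩⟩
  inject L hL L' hL' hr := exists_isInjection_of_centered (hS hL).1 (hS hL).2 (hS hL').1 hr

lemma isDefiningFamily_centeredCharts
    (hcov : ∀ p : M, ∃ L : LUS M, L.IsChart ∧ p ∈ Set.range L.φ) :
    IsDefiningFamily (centeredCharts M) := by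
  refine isDefiningFamily_of_centered subset_rfl (fun p ↦ ?_) fun _ _ _ hK _ ↦ hK
  obtain ⟨L, hL, hp⟩ := hcov p
  obtain ⟨K, hK, hKc, hpK, -⟩ := hL.exists_centered hp isOpen_univ trivial
  exact ⟨K, ⟨hK, hKc⟩, hpK⟩

variable {F : Set (LUS M)}

lemma isDefiningFamily_centeredBelow (hF : IsDefiningFamily F) (hFc : ∀ L ∈ F, L.IsChart) :
    IsDefiningFamily (centeredBelow F) := by
  refine isDefiningFamily_of_centered (centeredBelow_subset F) (fun p ↦ ?_) ?_
  · obtain ⟨L, hL, hp⟩ := hF.exists_mem p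
    obtain ⟨K, hK, hKc, hpK, hsub⟩ := (hFc L hL).exists_centered hp isOpen_univ trivial
    exact ⟨K, ⟨⟨hK, hKc⟩, L, hL, fun q hq ↦ (hsub hq).2⟩, hpK⟩
  · rintro L ⟨-, L', hL', hr⟩ K hK hKL
    exact ⟨hK, L', hL', hKL.trans hr⟩

/-- The union of `F` with all centered charts can fail to be a defining family: an annulus doubly
covering an annulus does not inject into a disc containing its image. Hence the restriction to
centered charts below a member of `F`. -/
lemma isDefiningFamily_union_centeredBelow (hF : IsDefiningFamily F)
    (hFc : ∀ L ∈ F, L.IsChart) : IsDefiningFamily (F ∪ centeredBelow F) where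
  covers p := by
    obtain ⟨L, hL, hp⟩ := hF.exists_mem p
    exact ⟨_, ⟨L, Or.inl hL, rfl⟩, hp⟩
  refines := by
    rintro p _ _ ⟨L₁, hL₁, rfl⟩ ⟨L₂, -, rfl⟩ hp hp'
    have h₁ : L₁.IsChart := hL₁.elim (hFc L₁) fun h ↦ h.1.1
    obtain ⟨L, hL, hr⟩ : ∃ L ∈ F, Set.range L₁.φ ⊆ Set.range L.φ :=
      hL₁.elim (fun h ↦ ⟨L₁, h, subset_rfl⟩) fun h ↦ h.2
    obtain ⟨K, hK, hKc, hpK, hsub⟩ := h₁.exists_centered hp L₂.isOpen_range hp'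
    exact ⟨_, ⟨K, Or.inr ⟨⟨hK, hKc⟩, L, hL, fun q hq ↦ hr (hsub hq).2⟩, rfl⟩, hpK,
      fun q hq ↦ ⟨(hsub hq).2, (hsub hq).1⟩⟩
  inject := by
    rintro L (hL | hL) L' hL' hr
    swap
    · exact exists_isInjection_of_centered hL.1.1 hL.1.2 (hL'.elim (hFc L') fun h ↦ h.1.1) hr
    rcases hL' with hL' | ⟨⟨hL', hc⟩, L₀, hL₀, hr₀⟩
    · exact hF.inject L hL L' hL' hr
    -- The domain of `L` need not be convex, so the lift to the centered chart is obtained by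
    -- comparing both inside `L₀`.
    obtain ⟨f, hf⟩ := hF.inject L hL L₀ hL₀ (hr.trans hr₀)
    obtain ⟨l, hl, -, μ, -, hμ⟩ := hf.exists_isLift
    obtain ⟨l₁, hl₁⟩ := IsLift.exists_of_convex hL' (hFc L₀ hL₀) hr₀ hc.1
    obtain ⟨l', hl', hinj⟩ :=
      hl.exists_of_range_subset hl₁ hL' (hFc L₀ hL₀) hc hr
    have hli : Set.InjOn l L.dom := Set.LeftInvOn.injOn (f₁' := μ) hμ
    exact ⟨_, hl'.isInjection (hFc L hL) hL' (hinj hli)⟩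

/-- A defining family of charts is equivalent to the family of all centered charts. -/
lemma equivalent_centeredCharts (F : DefiningFamily M) (hFc : ∀ L ∈ F.1, L.IsChart)
    (hS : IsDefiningFamily (centeredCharts M)) : Equivalent F ⟨centeredCharts M, hS⟩ := by
  have h1 : DirectlyEquivalent F ⟨_, isDefiningFamily_centeredBelow F.2 hFc⟩ :=
    ⟨⟨_, isDefiningFamily_union_centeredBelow F.2 hFc⟩, Set.subset_union_left,
      Set.subset_union_right⟩
  have h2 : DirectlyEquivalent ⟨_, isDefiningFamily_centeredBelow F.2 hFc⟩
      ⟨centeredCharts M, hS⟩ :=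
    ⟨⟨_, hS⟩, centeredBelow_subset F.1, subset_rfl⟩
  exact (Relation.ReflTransGen.single h1).tail h2

end Compatible

/-! ### Equivalence of defining families and equality of diffeologies -/

section Equivalence

variable {M : Type u} [TopologicalSpace M]

/-- The members of the smaller family are charts for the larger diffeology and already cover M, so
they generate it. -/
lemma DefiningFamily.diffeology_eq_of_subset {F F' : DefiningFamily M} (h : F.1 ⊆ F'.1) :
    F.diffeology = F'.diffeology :=
  lusDiffeology_eq (d := F'.diffeology) (fun _ hL ↦ F'.2.isChart (h hL)) F.2.exists_mem

lemma Equivalent.diffeology_eq {F F' : DefiningFamily M} (h : Equivalent F F') :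
    F.diffeology = F'.diffeology := by
  induction h with
  | refl => rfl
  | tail _ h ih =>
    obtain ⟨F'', h₁, h₂⟩ := h
    rw [ih, DefiningFamily.diffeology_eq_of_subset h₁, DefiningFamily.diffeology_eq_of_subset h₂]

theorem DefiningFamily.diffeology_eq_iff (F F' : DefiningFamily M) :
    F.diffeology = F'.diffeology ↔ Equivalent F F' := by
  refine ⟨fun h ↦ ?_, Equivalent.diffeology_eq⟩
  let _ := F.diffeology
  have : IsDTopologyCompatible M := ⟨F.2.dTopology_eq⟩
  have hF : ∀ L ∈ F.1, L.IsChart := fun L hL ↦ F.2.isChart hL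
  have hF' : ∀ L ∈ F'.1, L.IsChart := fun L hL ↦ by
    have := F'.2.isChart hL
    rwa [show lusDiffeology F'.1 = F.diffeology from h.symm] at this
  have hS : IsDefiningFamily (centeredCharts M) :=
    isDefiningFamily_centeredCharts fun p ↦ by
      obtain ⟨L, hL, hp⟩ := F.2.exists_mem p
      exact ⟨L, hF L hL, hp⟩
  exact (equivalent_centeredCharts F hF hS).trans
    ((familySetoid M).symm (equivalent_centeredCharts F' hF' hS))

lemma DefiningFamily.isReflectionFreeOrbifold (F : DefiningFamily M) :
    @IsReflectionFreeOrbifold M F.diffeology := by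
  let _ := F.diffeology
  have : IsDTopologyCompatible M := ⟨F.2.dTopology_eq⟩
  intro p
  obtain ⟨L, hL, hp⟩ := F.2.exists_mem p
  rw [← L.image_ψ] at hp
  obtain ⟨x, hx, rfl⟩ := hp
  obtain ⟨K, hxK, -⟩ := (F.2.isChart hL).exists_linearChart hx isOpen_univ trivial
  exact ⟨K.dim, K.group, K.finite, K.not_isReflection, K.locallyDiffeomorphicAt hxK⟩

end Equivalence

/-- Both topologies are the D-topology, so they agree; after that the families live on one space and
can be compared there. -/
lemma VManifold.eq_of_diffeology_eq {M : Type u} (V V' : VManifold M)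
    {F : @DefiningFamily M V.top} (hF : F ∈ V.families)
    {F' : @DefiningFamily M V'.top} (hF' : F' ∈ V'.families)
    (h : V.diffeology F = V'.diffeology F') : V = V' := by
  obtain ⟨t, ht, c⟩ := V
  obtain ⟨t', ht', c'⟩ := V'
  have e : t = t' := by
    rw [← @IsDefiningFamily.dTopology_eq M t F.1 F.2, ← @IsDefiningFamily.dTopology_eq M t' F'.1 F'.2]
    exact congrArg (fun d ↦ d.dTopology) h
  subst e
  congr 1
  exact hF.symm.trans ((Quotient.sound ((DefiningFamily.diffeology_eq_iff F F').1 h)).trans hF')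

theorem IsReflectionFreeOrbifold.exists_vManifold {M : Type u} (d : DiffeologicalSpace M)
    (ht : @T2Space M d.dTopology) (h : @IsReflectionFreeOrbifold M d) :
    ∃ V : VManifold M, V.top = d.dTopology ∧ ∃ F ∈ V.families, V.diffeology F = d := by
  let _ := d.dTopology
  have : IsDTopologyCompatible M := ⟨rfl⟩
  have hcov : ∀ p : M, ∃ L ∈ centeredCharts M, p ∈ Set.range L.φ := by
    intro p
    obtain ⟨n, Γ, hfin, hrefl, hloc⟩ := h p
    obtain ⟨K, hpK⟩ := hloc.exists_linearChart hfin hrefl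
    obtain ⟨L, hL, hLc, hr⟩ := K.exists_lus
    exact ⟨L, ⟨hL, hLc⟩, hr ▸ hpK⟩
  have hS : IsDefiningFamily (centeredCharts M) :=
    isDefiningFamily_of_centered subset_rfl hcov fun _ _ _ hK _ ↦ hK
  exact ⟨⟨d.dTopology, ht, Quotient.mk _ ⟨_, hS⟩⟩, rfl, ⟨_, hS⟩, rfl,
    lusDiffeology_eq (fun L hL ↦ hL.1) hcov⟩

end Orbi

theorem mainTheorem1 (M : Type u) :
    -- A V-manifold, with the diffeology generated by any of its defining families,
    -- is a Hausdorff reflection-free diffeological orbifold; its D-topology is the given one.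
    (∀ (V : Orbi.VManifold M), ∀ F ∈ V.families,
      (V.diffeology F).dTopology = V.top ∧
      @T2Space M (V.diffeology F).dTopology ∧
      @Orbi.IsReflectionFreeOrbifold M (V.diffeology F)) ∧
    -- Two defining families generate the same diffeology exactly when they are equivalent.
    (∀ [TopologicalSpace M] [T2Space M] (F F' : Orbi.DefiningFamily M),
      F.diffeology = F'.diffeology ↔ Orbi.Equivalent F F') ∧
    -- The diffeology determines the V-manifold structure (topology and equivalence class).
    (∀ (V V' : Orbi.VManifold M), ∀ F ∈ V.families, ∀ F' ∈ V'.families,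
      V.diffeology F = V'.diffeology F' → V = V') ∧
    -- Every Hausdorff reflection-free diffeological orbifold arises in this way.
    (∀ d : DiffeologicalSpace M, @T2Space M d.dTopology → @Orbi.IsReflectionFreeOrbifold M d →
      ∃ V : Orbi.VManifold M, V.top = d.dTopology ∧ ∃ F ∈ V.families, V.diffeology F = d) := by
  refine ⟨fun V F _ ↦ ?_, fun F F' ↦ F.diffeology_eq_iff F',
    fun V V' F hF F' hF' h ↦ V.eq_of_diffeology_eq V' hF hF' h,
    fun d ht h ↦ h.exists_vManifold d ht⟩
  let _ := V.top
  have e : (V.diffeology F).dTopology = V.top := F.2.dTopology_eq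
  exact ⟨e, e ▸ V.t2, Orbi.DefiningFamily.isReflectionFreeOrbifold F⟩
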